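/- **Theorem 3 ($O(\sqrt n)$ bits, $O(\lg n)$ time).** Write $\lg=\log_2$. (1) *Upper bound.* There are a constant $C$ and one fixed word-RAM program such that the following holds for every $n\ge 2$, every partition of an $n$-element set into equivalence classes and every word length $w$ with $n<2^w$ (so that a label fits into a word). One can relabel the elements by $1,\dots,n$, each label being used exactly once, and choose a bit string of length at most $C\sqrt n$ such that, with this bit string stored in memory (packed into words of $w$ bits, read-only), the program decides from the labels of any two elements whether they are in the same class in at most $C\lg n$ steps. Each step is one of: addition, subtraction or multiplication modulo $2^w$, a bitwise Boolean operation, a shift, loading a constant, reading a memory word, a jump, or a comparison with a conditional jump. The program uses a constant number of registers as working space; the word length $w$ is available in a register. (2) *Lower bound.* $\Omega(\sqrt n)$ bits are necessary: there is a constant $c>0$ such that for every $n\ge 2$ the following holds. Suppose that to each partition of an $n$-element set a relabeling of the elements by $1,\dots,n$ and a bit string are assigned, in such a way that whether two elements are equivalent is determined (by any rule whatsoever) by the bit string and the labels of the two elements. Then some partition is assigned a bit string of length at least $c\sqrt n$. (3) *Number of partitions.* The number $p(n)$ of partitions of the integer $n$, that is, of partitions of an $n$-element set up to relabeling, is $2^{\Theta(\sqrt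 n)}$: there are constants $c,C>0$ with $2^{c\sqrt n}\le p(n)\le 2^{C\sqrt n}$ for all $n\ge 2$. (4) There is a constant $C$ with the following property. Let a partition of an $n$-element set have classes of exactly $k$ distinct sizes $s_1,\dots,s_k$, with $n_j\ge 1$ classes of size $s_j$, ordered so that $s_1n_1\le s_2n_2\le\dots\le s_kn_k$, and put $\delta_j=s_jn_j-s_{j-1}n_{j-1}$ with $s_0n_0=0$. Then $$\sum_{1\le j\le k,\ \delta_j\ge 1}\lg\delta_j\le C\sqrt n\qquad\text{and}\qquad\sum_{j=1}^k\lg n_j\le C\sqrt n .$$ -/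

import Mathlib

universe u

/-! ### The word RAM

Words have `w` bits. A program is a fixed finite list of instructions that does not depend on `w`;
each instruction takes one time step. Registers have fixed (static) numbers, so a program uses only
constantly many words of working space. The data structure lies in a read-only memory of words. -/

namespace WordRAM

/-- The unit-cost operations on words: arithmetic modulo `2 ^ w`, bitwise Boolean operations and
left and right shifts. Integer division is not available. -/
inductive BinOp where
  | add | sub | mul | and | or | xor | shl | shr

/-- The value of an operation on two words. -/
def BinOp.eval {w : ℕ} : BinOp → BitVec w → BitVec w → BitVec w
  | .add, x, y => x + y
  | .sub, x, y => x - y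
  | .mul, x, y => x * y
  | .and, x, y => x &&& y
  | .or, x, y => x ||| y
  | .xor, x, y => x ^^^ y
  | .shl, x, y => x <<< y
  | .shr, x, y => x >>> y

/-- The instructions. Here `d`, `a`, `b` are register numbers and `t` is an instruction number. -/
inductive Instr where
  /-- write the constant `c`, modulo `2 ^ w`, to register `d` -/
  | const (d c : ℕ)
  /-- apply an operation to the contents of registers `a` and `b`, and write the result to `d` -/
  | op (o : BinOp) (d a b : ℕ)
  /-- write to `d` the memory word whose address is in register `a` -/
  | load (d a : ℕ)
  /-- go to instruction `t` -/
  | jump (t : ℕ)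
  /-- go to instruction `t` if the contents of `a` and `b` are equal -/
  | jeq (a b t : ℕ)
  /-- go to instruction `t` if the content of `a` is less than that of `b` (as natural numbers) -/
  | jlt (a b t : ℕ)

/-- A program is a finite list of instructions, numbered from `0`. -/
abbrev Program := List Instr

/-- A configuration: the program counter and the contents of the registers. -/
structure Config (w : ℕ) where
  pc : ℕ
  reg : ℕ → BitVec w

/-- The effect of one instruction, for the memory contents `mem`. -/
def Instr.exec {w : ℕ} (mem : BitVec w → BitVec w) (s : Config w) : Instr → Config w
  | .const d c => ⟨s.pc + 1, Function.update s.reg d (BitVec.ofNat w c)⟩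
  | .op o d a b => ⟨s.pc + 1, Function.update s.reg d (o.eval (s.reg a) (s.reg b))⟩
  | .load d a => ⟨s.pc + 1, Function.update s.reg d (mem (s.reg a))⟩
  | .jump t => ⟨t, s.reg⟩
  | .jeq a b t => ⟨if s.reg a = s.reg b then t else s.pc + 1, s.reg⟩
  | .jlt a b t => ⟨if (s.reg a).toNat < (s.reg b).toNat then t else s.pc + 1, s.reg⟩

/-- One step. The machine has halted once the program counter points outside the program. -/
def step {w : ℕ} (P : Program) (mem : BitVec w → BitVec w) (s : Config w) : Config w :=
  match P[s.pc]? with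
  | none => s
  | some i => i.exec mem s

/-- The memory that holds the bit string `D`, packed into words of `w` bits from address `0` on:
bit `i` of the word at address `a` is the bit number `a * w + i` of `D`, and is `0` beyond `D`. -/
def pack (w : ℕ) (D : List Bool) (a : BitVec w) : BitVec w :=
  BitVec.ofFnLE fun i : Fin w => D.getD (a.toNat * w + i) false

/-- The initial configuration of a query `(x, y)`: registers `0` and `1` hold `x` and `y`,
register `2` holds the word length, and all other registers are `0`. -/
def initial (w x y : ℕ) : Config w where
  pc := 0
  reg i := if i = 0 then BitVec.ofNat w x else if i = 1 then BitVec.ofNat w y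
    else if i = 2 then BitVec.ofNat w w else 0

/-- On words of `w` bits and with the bit string `D` in memory, the program `P` answers the query
`(x, y)` with the word `v` (in register `0`) within `t` steps. -/
def AnswersWithin (P : Program) (w : ℕ) (D : List Bool) (x y : ℕ) (v : BitVec w) (t : ℕ) : Prop :=
  ∃ t' ≤ t, P.length ≤ ((step P (pack w D))^[t'] (initial w x y)).pc ∧
    ((step P (pack w D))^[t'] (initial w x y)).reg 0 = v

end WordRAM

/-- A labeling of the elements of a finite set of `n` elements: each label `1, …, n` is used
exactly once. -/
def IsLabeling {α : Type u} [Fintype α] (label : α → ℕ) : Prop :=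
  Set.BijOn label Set.univ (Set.Icc 1 (Fintype.card α))

/-! The bounds rest on one estimate: if the `t j` are distinct positive integers, the `a j` are
positive integers and `∑ t j * a j ≤ n`, then `∑ lg (a j) = O(√n)`. Put `M = √n`. Then `log a ≤ t *
a / M + log (M / t)`. The first terms add up to at most `M`. The product of `k` distinct positive
integers is at least `k!`, so the second terms add up to at most `log (M ^ k / k!) ≤ M`. This is
`sum_log_le_of_weights`. Class sizes as weights bound the multiplicities. For increments of an
increasing sequence, Abel summation supplies the distinct weights `k + 1 - j`.

Upper bound: list the elements class by class, in order of class size, and label them by position.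
Two elements are equivalent iff their classes have the same first position. The class sizes are
described by increments of the distinct sizes and by multiplicities, all in binary; this is a
sequence of `O(√n)` operations on a state (`length_groupOps_le`). The sequence is cut into blocks of
`L = Θ(lg n)` operations, and the state before each block is stored. A state takes `O(L)` bits, so
storage grows by a constant factor only, up to `O(L)` bits. A query finds by binary search the last
block that starts at or before the element, runs its `L` operations until the element is passed, and
obtains the offset in the class by shift-and-subtract division: `O(lg n)` steps (`within_main`).
Each word holds a power of two of slots, so addressing needs no division. For `n < 2 ^ 18` a linear
scan of a characteristic sequence is good enough.

Lower bound: partitions with the same bit string are isomorphic through their labelings, so there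
are at least `p(n)` bit strings (`card_partition_lt_of_store`). Subsets of `{2, …, m + 1}` padded
with ones give `p(n) ≥ 2 ^ m` for some `m` of order `√n`. The upper bound for `p(n)` is the same
counting lemma, applied to the data structure just built. -/

/-! ### Sums of logarithms under a linear constraint with distinct weights -/

/-- This is `log u ≤ u - 1` at `u = t * a / M`, with the `-1` given away. -/
theorem log_le_linear {a t M : ℝ} (ha : 0 < a) (ht : 0 < t) (hM : 0 < M) :
    Real.log a ≤ t * a / M + Real.log (M / t) := by
  have h := Real.log_le_sub_one_of_pos (show 0 < t * a / M by positivity)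
  have e : Real.log a = Real.log (t * a / M) + Real.log (M / t) := by
    rw [← Real.log_mul (by positivity) (by positivity)]
    congr 1
    field_simp
  linarith

/-- The largest element exceeds the number of the others, since these all lie between `1` and it; so
it supplies the next factor of the factorial. -/
theorem factorial_card_le_prod (S : Finset ℕ) (hS : ∀ t ∈ S, 1 ≤ t) :
    S.card.factorial ≤ ∏ t ∈ S, t := by
  induction S using Finset.induction_on_max with
  | empty => simp
  | insert a s hmax ih =>
    have hna : a ∉ s := fun h => lt_irrefl _ (hmax a h)
    rw [Finset.card_insert_of_notMem hna, Finset.prod_insert hna, Nat.factorial_succ]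
    refine Nat.mul_le_mul ?_ (ih fun t ht => hS t (Finset.mem_insert_of_mem ht))
    have : s.card ≤ (Finset.Ico 1 a).card := Finset.card_le_card fun t ht =>
      Finset.mem_Ico.2 ⟨hS t (Finset.mem_insert_of_mem ht), hmax t ht⟩
    have h1 := hS a (Finset.mem_insert_self _ _)
    rw [Nat.card_Ico] at this
    omega

/-- The sum is the logarithm of `M ^ k / ∏ t`, which is at most `M ^ k / k!`, a single term of the
exponential series of `M`. -/
theorem sum_log_div_le (S : Finset ℕ) (hS : ∀ t ∈ S, 1 ≤ t) {M : ℝ} (hM : 0 < M) :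
    ∑ t ∈ S, Real.log (M / t) ≤ M := by
  have hpos : ∀ t ∈ S, (0 : ℝ) < t := fun t ht => by exact_mod_cast hS t ht
  rw [← Real.log_prod (fun t ht => by have := hpos t ht; positivity), Finset.prod_div_distrib,
    Finset.prod_const]
  have hP : (0 : ℝ) < ∏ t ∈ S, (t : ℝ) := Finset.prod_pos hpos
  rw [Real.log_le_iff_le_exp (by positivity)]
  refine le_trans ?_ (Real.pow_div_factorial_le_exp M hM.le S.card)
  refine div_le_div_of_nonneg_left (by positivity) (by positivity) ?_
  rw [← Nat.cast_prod (R := ℝ) (fun t => t) S]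
  exact_mod_cast factorial_card_le_prod S hS

theorem sum_log_le_of_weights {ι : Type*} (J : Finset ι) (t a : ι → ℕ) (ht : ∀ j ∈ J, 1 ≤ t j)
    (ha : ∀ j ∈ J, 1 ≤ a j) (hinj : Set.InjOn t J) {M : ℝ} (hM : 0 < M) :
    ∑ j ∈ J, Real.log (a j) ≤ ((∑ j ∈ J, t j * a j : ℕ) : ℝ) / M + M := by
  have h1 : ∑ j ∈ J, Real.log (a j) ≤
      ∑ j ∈ J, ((t j : ℝ) * a j / M + Real.log (M / t j)) :=
    Finset.sum_le_sum fun j hj => log_le_linear (by exact_mod_cast ha j hj)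
      (by exact_mod_cast ht j hj) hM
  rw [Finset.sum_add_distrib, ← Finset.sum_div] at h1
  have h2 : ∑ j ∈ J, Real.log (M / t j) ≤ M := by
    have := sum_log_div_le (J.image t) (by simpa using ht) hM
    rwa [Finset.sum_image hinj] at this
  push_cast
  linarith

/-- The choice `M = √n` balances the two terms `n / M` and `M`; the constant `4` covers `2 / log 2`.
-/
theorem sum_logb_le_sqrt {ι : Type*} (J : Finset ι) (t a : ι → ℕ) (ht : ∀ j ∈ J, 1 ≤ t j)
    (ha : ∀ j ∈ J, 1 ≤ a j) (hinj : Set.InjOn t J) {n : ℕ} (hn : ∑ j ∈ J, t j * a j ≤ n) :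
    ∑ j ∈ J, Real.logb 2 (a j) ≤ 4 * √(n : ℝ) := by
  rcases J.eq_empty_or_nonempty with rfl | ⟨j, hj⟩
  · simp
  have hn1 : 1 ≤ n := by
    refine le_trans (Nat.mul_pos (ht j hj) (ha j hj)) (le_trans ?_ hn)
    exact Finset.single_le_sum (f := fun j => t j * a j) (fun _ _ => Nat.zero_le _) hj
  have hM : 0 < √(n : ℝ) := Real.sqrt_pos.2 (by exact_mod_cast hn1)
  have h := sum_log_le_of_weights J t a ht ha hinj hM
  have h2 : ((∑ j ∈ J, t j * a j : ℕ) : ℝ) / √(n : ℝ) ≤ √(n : ℝ) := by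
    rw [div_le_iff₀ hM, Real.mul_self_sqrt (by positivity)]
    exact_mod_cast hn
  have hl : (1 : ℝ) / 2 < Real.log 2 := by linarith [Real.log_two_gt_d9]
  simp only [Real.logb]
  rw [← Finset.sum_div, div_le_iff₀ (by linarith)]
  nlinarith

/-- Abel summation: `δ j` is part of each of `f j, …, f k`, hence is counted `k + 1 - j` times. The
plain sum of the increments is carried along for the induction. -/
theorem sum_weighted_increments (f δ : ℕ → ℕ) (h0 : f 0 = 0) (k : ℕ)
    (h : ∀ j ∈ Finset.Icc 1 k, f j = f (j - 1) + δ j) :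
    ∑ j ∈ Finset.Icc 1 k, δ j = f k ∧
      ∑ j ∈ Finset.Icc 1 k, (k + 1 - j) * δ j = ∑ j ∈ Finset.Icc 1 k, f j := by
  induction k with
  | zero => simp [h0]
  | succ k ih =>
    obtain ⟨h1, h2⟩ := ih fun j hj => h j (by simp at hj ⊢; omega)
    have hk := h (k + 1) (by simp)
    have hs : ∑ j ∈ Finset.Icc 1 (k + 1), δ j = f (k + 1) := by
      rw [Finset.sum_Icc_succ_top (by omega), h1, hk]; simp
    refine ⟨hs, ?_⟩
    rw [Finset.sum_Icc_succ_top (b := k) (f := f) (by omega), ← h2, ← hs,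
      Finset.sum_Icc_succ_top (by omega), Finset.sum_Icc_succ_top (by omega), ← add_assoc,
      ← Finset.sum_add_distrib]
    congr 1
    · refine Finset.sum_congr rfl fun j hj => ?_
      rw [Finset.mem_Icc] at hj
      rw [show k + 1 + 1 - j = (k + 1 - j) + 1 by omega, add_mul, one_mul]
    · simp

theorem sum_logb_increments_and_multiplicities (n k : ℕ) (s m δ : ℕ → ℕ)
    (hpos : ∀ j ∈ Finset.Icc 1 k, 1 ≤ s j ∧ 1 ≤ m j) (hinj : Set.InjOn s (Set.Icc 1 k))
    (h0 : s 0 * m 0 = 0)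
    (hδ : ∀ j ∈ Finset.Icc 1 k, s j * m j = s (j - 1) * m (j - 1) + δ j)
    (hn : ∑ j ∈ Finset.Icc 1 k, s j * m j = n) :
    ∑ j ∈ Finset.Icc 1 k with 1 ≤ δ j, Real.logb 2 (δ j) ≤ 4 * √(n : ℝ) ∧
      ∑ j ∈ Finset.Icc 1 k, Real.logb 2 (m j) ≤ 4 * √(n : ℝ) := by
  constructor
  -- The weights are distinct, and the weighted sum over all `j` is exactly `n`; dropping the zero
  -- increments does not increase it.
  · refine sum_logb_le_sqrt _ (fun j => k + 1 - j) δ ?_ ?_ ?_ ?_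
    · intro j hj
      simp only [Finset.mem_filter, Finset.mem_Icc] at hj
      omega
    · intro j hj
      exact (Finset.mem_filter.1 hj).2
    · intro i hi j hj hij
      simp only [Finset.coe_filter, Finset.mem_Icc, Set.mem_ofPred_eq] at hi hj hij
      omega
    · rw [← hn, ← (sum_weighted_increments (fun j => s j * m j) δ h0 k hδ).2]
      exact Finset.sum_le_sum_of_subset (Finset.filter_subset _ _)
  · exact sum_logb_le_sqrt _ s m (fun j hj => (hpos j hj).1) (fun j hj => (hpos j hj).2)
      (by simpa using hinj) hn.le

/-! ### Counting: bit strings against integer partitions -/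

/-- The number of elements whose class under `r` has exactly `v` elements. -/
noncomputable def classProfile {α : Type u} (r : Setoid α) (v : ℕ) : ℕ :=
  Nat.card {x : α // Nat.card {y : α // r x y} = v}

theorem classProfile_congr {α β : Type*} {r : Setoid α} {s : Setoid β} (e : α ≃ β)
    (he : ∀ x y, r x y ↔ s (e x) (e y)) : classProfile r = classProfile s := by
  funext v
  refine Nat.card_congr (e.subtypeEquiv fun x => ?_)
  rw [Nat.card_congr (e.subtypeEquiv fun y => he x y)]

/-- The model is the disjoint union of one set for each part, with the fibres of the projection as
classes. Counting elements instead of classes produces the factor `v`. -/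
theorem exists_setoid_classProfile {α : Type u} [Fintype α] {n : ℕ} (hα : Fintype.card α = n)
    (π : Nat.Partition n) :
    ∃ r : Setoid α, ∀ v, classProfile r v = v * π.parts.count v := by
  classical
  set l := π.parts.toList with hl
  have hcard : Fintype.card α = Fintype.card (Σ i : Fin l.length, Fin (l.get i)) := by
    rw [Fintype.card_sigma, hα]
    simp only [Fintype.card_fin]
    rw [← List.sum_ofFn, List.ofFn_get, hl, Multiset.sum_toList, π.parts_sum]
  let e := Fintype.equivOfCardEq hcard
  let s : Setoid (Σ i : Fin l.length, Fin (l.get i)) := Setoid.ker Sigma.fst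
  refine ⟨s.comap e, fun v => ?_⟩
  rw [classProfile_congr (s := s) e fun x y => Iff.rfl]
  have hc : ∀ x : Σ i : Fin l.length, Fin (l.get i), Nat.card {y // s x y} = l.get x.1 := by
    intro x
    rw [Nat.subtype_card (Finset.univ.filter fun y : Σ i : Fin l.length, Fin (l.get i) =>
      x.1 = y.1) (by intro y; simp [s, Setoid.ker_def]), Finset.card_filter, Fintype.sum_sigma]
    simp [apply_ite Finset.card]
  simp only [classProfile, hc]
  rw [Nat.subtype_card (Finset.univ.filter fun y : Σ i : Fin l.length, Fin (l.get i) =>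
      l.get y.1 = v) (by intro y; simp), Finset.card_filter, Fintype.sum_sigma]
  have hcount : π.parts.count v = ∑ i : Fin l.length, if l.get i = v then 1 else 0 := by
    rw [← Finset.card_filter, ← Multiset.coe_toList π.parts, ← hl]
    conv_lhs => rw [← List.ofFn_get l, ← Fin.univ_val_map, Multiset.count_map]
    simp only [eq_comm (a := v)]
    rfl
  rw [hcount, Finset.mul_sum]
  refine Finset.sum_congr rfl fun i _ => ?_
  by_cases h : l.get i = v
  · simp [← h]
  · simp only [h, if_false, mul_zero, Finset.sum_const_zero]

/-- The number with binary digits `1` followed by the reverse of the bit string. -/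
def bitStringCode : List Bool → ℕ
  | [] => 1
  | b :: l => 2 * bitStringCode l + b.toNat

theorem bitStringCode_bounds (l : List Bool) :
    1 ≤ bitStringCode l ∧ bitStringCode l < 2 ^ (l.length + 1) := by
  induction l with
  | nil => simp [bitStringCode]
  | cons b l ih =>
    have := b.toNat_le
    simp only [bitStringCode, List.length_cons]
    rw [pow_succ]
    omega

theorem bitStringCode_injective : Function.Injective bitStringCode := by
  intro l
  induction l with
  | nil =>
    intro l' h
    cases l' with
    | nil => rfl
    | cons b l' =>
      have := (bitStringCode_bounds l').1
      simp only [bitStringCode] at h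
      omega
  | cons b l ih =>
    intro l' h
    cases l' with
    | nil =>
      have := (bitStringCode_bounds l).1
      simp only [bitStringCode] at h
      omega
    | cons b' l' =>
      simp only [bitStringCode] at h
      have h1 := b.toNat_lt
      have h2 := b'.toNat_lt
      rw [ih (show bitStringCode l = bitStringCode l' by omega)]
      rw [show b = b' by cases b <;> cases b' <;> simp at h ⊢ <;> omega]

/-- The leading digit `1` makes strings of different lengths distinguishable, and strings shorter
than `l` have codes in `[1, 2 ^ l)`. -/
theorem card_lt_of_injective_bitString {β : Type*} [Fintype β] (f : β → List Bool)
    (hf : Function.Injective f) (l : ℕ) (hl : ∀ b, (f b).length < l) :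
    Fintype.card β < 2 ^ l := by
  have : Fintype.card β ≤ (Finset.Ico 1 (2 ^ l)).card := by
    rw [← Finset.card_univ]
    refine Finset.card_le_card_of_injOn (fun b => bitStringCode (f b)) (fun b _ => ?_)
      (fun a _ b _ h => hf (bitStringCode_injective h))
    have := bitStringCode_bounds (f b)
    simp only [Finset.coe_Ico, Set.mem_Ico]
    exact ⟨this.1, this.2.trans_le (Nat.pow_le_pow_right (by omega) (hl b))⟩
  rw [Nat.card_Ico] at this
  have := Nat.two_pow_pos l
  omega

/-- If two set partitions have the same bit string, one labeling followed by the inverse of the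
other carries the first relation to the second, because both are decided by the same rule on labels.
Hence they have the same class sizes, and the bit string determines the integer partition. -/
theorem card_partition_lt_of_store {α : Type u} [Fintype α] (label : Setoid α → α → ℕ)
    (store : Setoid α → List Bool) (answer : List Bool → ℕ → ℕ → Prop)
    (hlabel : ∀ r, IsLabeling (label r))
    (hans : ∀ (r : Setoid α) (x y : α), answer (store r) (label r x) (label r y) ↔ r x y)
    (l : ℕ) (hl : ∀ r, (store r).length < l) :
    Fintype.card (Nat.Partition (Fintype.card α)) < 2 ^ l := by
  choose r hr using exists_setoid_classProfile (α := α) rfl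
  refine card_lt_of_injective_bitString (fun π => store (r π)) (fun π π' h => ?_) l
    (fun π => hl _)
  let e (s : Setoid α) : α ≃ Set.Icc 1 (Fintype.card α) :=
    (Equiv.Set.univ α).symm.trans (hlabel s).equiv
  have he : ∀ s x, (e s x : ℕ) = label s x := fun s x => rfl
  have hprof := classProfile_congr (r := r π) (s := r π') ((e (r π)).trans (e (r π')).symm) (by
    intro x y
    rw [← hans (r π), ← hans (r π'), ← he (r π'), ← he (r π')]
    simp only [Equiv.trans_apply, Equiv.apply_symm_apply, he]
    rw [show store (r π) = store (r π') from h])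
  refine Nat.Partition.ext (Multiset.ext.2 fun v => ?_)
  -- The profile carries a factor `v`, which cannot be cancelled at `v = 0`; but `0` is never a
  -- part.
  rcases Nat.eq_zero_or_pos v with rfl | hv
  · rw [Multiset.count_eq_zero_of_notMem fun h0 => lt_irrefl _ (π.parts_pos h0),
      Multiset.count_eq_zero_of_notMem fun h0 => lt_irrefl _ (π'.parts_pos h0)]
  · have := congrFun hprof v
    rw [hr, hr] at this
    exact Nat.eq_of_mul_eq_mul_left hv this

/-! ### The number of integer partitions from below -/

/-- Every subset of `{2, …, m + 1}` has sum at most `m * (m + 3) / 2 ≤ n` and is completed to a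
partition of `n` by ones. The subset is recovered as the set of parts that are at least `2`. -/
theorem two_pow_le_card_partition {n m : ℕ} (h : m * (m + 3) ≤ 2 * n) :
    2 ^ m ≤ Fintype.card (Nat.Partition n) := by
  classical
  have hsum : ∀ A ∈ (Finset.Ico 2 (m + 2)).powerset, ∑ a ∈ A, a ≤ n := by
    intro A hA
    have h1 : ∑ a ∈ A, a ≤ ∑ a ∈ Finset.Ico 2 (m + 2), a :=
      Finset.sum_le_sum_of_subset (Finset.mem_powerset.1 hA)
    have h2 : ∀ m, 2 * ∑ a ∈ Finset.Ico 2 (m + 2), a = m * (m + 3) := by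
      intro m
      induction m with
      | zero => simp
      | succ m ih => rw [Finset.sum_Ico_succ_top (by omega), mul_add, ih]; ring
    have := h2 m
    omega
  let f (A : (Finset.Ico 2 (m + 2)).powerset) : Nat.Partition n :=
    { parts := A.1.val + Multiset.replicate (n - ∑ a ∈ A.1, a) 1
      parts_pos := by
        intro i hi
        rcases Multiset.mem_add.1 hi with hi | hi
        · have := Finset.mem_Ico.1 (Finset.mem_powerset.1 A.2 hi)
          omega
        · rw [Multiset.eq_of_mem_replicate hi]; exact one_pos
      parts_sum := by
        have := hsum A.1 A.2
        have e : A.1.val.sum = ∑ a ∈ A.1, a := (Finset.sum_val A.1)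
        rw [Multiset.sum_add, Multiset.sum_replicate, e]
        simp
        omega }
  have hf : Function.Injective f := by
    intro A B hAB
    have hmem : ∀ (A : (Finset.Ico 2 (m + 2)).powerset) (v : ℕ),
        v ∈ A.1 ↔ 2 ≤ v ∧ v ∈ (f A).parts := by
      intro A v
      simp only [f, Multiset.mem_add, Finset.mem_val, Multiset.mem_replicate]
      constructor
      · intro hv
        exact ⟨(Finset.mem_Ico.1 (Finset.mem_powerset.1 A.2 hv)).1, Or.inl hv⟩
      · rintro ⟨h2, hv | hv⟩
        · exact hv
        · omega
    refine Subtype.ext (Finset.ext fun v => ?_)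
    rw [hmem, hmem, hAB]
  have := Fintype.card_le_of_injective f hf
  rwa [Fintype.card_coe, Finset.card_powerset, Nat.card_Ico, Nat.add_sub_cancel] at this

theorem exists_two_pow_le_card_partition {n : ℕ} (hn : 2 ≤ n) :
    ∃ m : ℕ, √(n : ℝ) / 4 ≤ m ∧ 2 ^ m ≤ Fintype.card (Nat.Partition n) := by
  have hs : √(n : ℝ) < Nat.sqrt n + 1 := by
    rw [Real.sqrt_lt' (by positivity)]
    exact_mod_cast (Nat.lt_succ_sqrt n).trans_eq (by rw [Nat.succ_eq_add_one]; ring)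
  by_cases h : Nat.sqrt n < 2
  -- Here `n < 4`, and half the integer square root would round down to `0`.
  · refine ⟨1, ?_, two_pow_le_card_partition (by omega)⟩
    have : (Nat.sqrt n : ℝ) ≤ 1 := by exact_mod_cast Nat.lt_succ_iff.1 h
    push_cast
    linarith
  · have hm : 2 * (Nat.sqrt n / 2) ≤ Nat.sqrt n := Nat.mul_div_le _ _
    refine ⟨Nat.sqrt n / 2, ?_, two_pow_le_card_partition ?_⟩
    · have h4 : Nat.sqrt n + 1 ≤ 4 * (Nat.sqrt n / 2) := by omega
      have : (Nat.sqrt n : ℝ) + 1 ≤ 4 * ((Nat.sqrt n / 2 : ℕ) : ℝ) := by exact_mod_cast h4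
      linarith
    · have h1 := Nat.sqrt_le n
      set k := Nat.sqrt n / 2
      have hk : 1 ≤ k := by omega
      nlinarith

theorem rpow_sqrt_le_card_partition {n : ℕ} (hn : 2 ≤ n) :
    (2 : ℝ) ^ (1 / 4 * √(n : ℝ)) ≤ (Fintype.card (Nat.Partition n) : ℝ) := by
  obtain ⟨m, hm, hp⟩ := exists_two_pow_le_card_partition hn
  calc (2 : ℝ) ^ (1 / 4 * √(n : ℝ)) ≤ (2 : ℝ) ^ (m : ℝ) :=
        Real.rpow_le_rpow_of_exponent_le (by norm_num) (by linarith)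
    _ ≤ _ := by rw [Real.rpow_natCast]; exact_mod_cast hp

theorem exists_store_length_ge {α : Type u} [Fintype α] (hα : 2 ≤ Fintype.card α)
    (label : Setoid α → α → ℕ) (store : Setoid α → List Bool)
    (answer : List Bool → ℕ → ℕ → Prop) (hlabel : ∀ r, IsLabeling (label r))
    (hans : ∀ (r : Setoid α) (x y : α), answer (store r) (label r x) (label r y) ↔ r x y) :
    ∃ r, 1 / 4 * √(Fintype.card α : ℝ) ≤ ((store r).length : ℝ) := by
  obtain ⟨m, hm, hp⟩ := exists_two_pow_le_card_partition hα
  by_contra! hcon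
  refine absurd (card_partition_lt_of_store label store answer hlabel hans m fun r => ?_)
    (not_lt.2 hp)
  have := (hcon r).trans_le (show _ ≤ (m : ℝ) by linarith)
  exact_mod_cast this

/-! ### The class sizes as a sequence of one-bit operations -/

/-- One step of the machine that decodes the sequence of classes. A state `(p, s, c)` holds the
number `p` of elements passed so far, the current class size `s` and an accumulator `c`.
An operation either appends a bit to the accumulator, or adds the accumulator to the size, or passes
`c` classes of size `s`. -/
def opStep : ℕ × ℕ × ℕ → Bool × Bool → ℕ × ℕ × ℕ
  | (p, s, c), (false, b) => (p, s, 2 * c + b.toNat)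
  | (p, s, c), (true, false) => (p, s + c, 0)
  | (p, s, c), (true, true) => (p + s * c, s, 0)

/-- The binary digits of a number, the most significant one first, as operations. -/
def digitOps (g : ℕ) : List (Bool × Bool) :=
  if g = 0 then [] else digitOps (g / 2) ++ [(false, decide (g % 2 = 1))]
termination_by g

/-- The operations that describe `R.length` groups of classes, the pairs in `R` being the class
size and the number of classes in the group. Sizes are given by their increments. -/
def groupOps : ℕ → List (ℕ × ℕ) → List (Bool × Bool)
  | _, [] => []
  | prev, (s, m) :: R =>
    (digitOps (s - prev) ++ [(true, false)]) ++ (digitOps m ++ [(true, true)]) ++ groupOps s R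

/-- The list of class sizes that belongs to a list of groups. -/
def groupSizes (R : List (ℕ × ℕ)) : List ℕ := R.flatMap fun g => List.replicate g.2 g.1

/-- If an interval of positions is cut into consecutive pieces of the given sizes, the first
position of the piece that contains `x`. -/
def pieceStart : List ℕ → ℕ → ℕ
  | [], x => x
  | c :: cs, x => if x < c then 0 else c + pieceStart cs (x - c)

/-- The first element of the class of `x`, found by running the operations from a state. -/
def findStart (x : ℕ) : ℕ × ℕ × ℕ → List (Bool × Bool) → ℕ
  | _, [] => x
  | st, o :: l => if x < (opStep st o).1 then x - (x - st.1) % st.2.1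
    else findStart x (opStep st o) l

/-- All states reached from `st` by the operations have entries at most `n`. -/
def StatesBounded (n : ℕ) : ℕ × ℕ × ℕ → List (Bool × Bool) → Prop
  | st, [] => st.1 ≤ n ∧ st.2.1 ≤ n ∧ st.2.2 ≤ n
  | st, o :: l => (st.1 ≤ n ∧ st.2.1 ≤ n ∧ st.2.2 ≤ n) ∧ StatesBounded n (opStep st o) l

theorem StatesBounded.head {n : ℕ} {st : ℕ × ℕ × ℕ} {l : List (Bool × Bool)}
    (h : StatesBounded n st l) : st.1 ≤ n ∧ st.2.1 ≤ n ∧ st.2.2 ≤ n := by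
  cases l with
  | nil => exact h
  | cons o l => exact h.1

theorem statesBounded_append {n : ℕ} (l₁ l₂ : List (Bool × Bool)) (st : ℕ × ℕ × ℕ) :
    StatesBounded n st (l₁ ++ l₂) ↔
      StatesBounded n st l₁ ∧ StatesBounded n (l₁.foldl opStep st) l₂ := by
  induction l₁ generalizing st with
  | nil => exact ⟨fun h => ⟨StatesBounded.head h, h⟩, fun h => h.2⟩
  | cons o l ih => simp [StatesBounded, ih, and_assoc]

theorem le_opStep_fst (st : ℕ × ℕ × ℕ) (o : Bool × Bool) : st.1 ≤ (opStep st o).1 := by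
  obtain ⟨p, s, c⟩ := st
  rcases o with ⟨_ | _, _ | _⟩ <;> simp [opStep]

theorem le_foldl_opStep_fst (l : List (Bool × Bool)) (st : ℕ × ℕ × ℕ) :
    st.1 ≤ (l.foldl opStep st).1 := by
  induction l generalizing st with
  | nil => exact le_rfl
  | cons o l ih => exact (le_opStep_fst st o).trans (ih _)

theorem findStart_append {x : ℕ} (l₁ l₂ : List (Bool × Bool)) (st : ℕ × ℕ × ℕ)
    (h : (l₁.foldl opStep st).1 ≤ x) :
    findStart x st (l₁ ++ l₂) = findStart x (l₁.foldl opStep st) l₂ := by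
  induction l₁ generalizing st with
  | nil => rfl
  | cons o l ih =>
    have h1 : ¬ x < (opStep st o).1 := not_lt.2 ((le_foldl_opStep_fst l _).trans h)
    simp only [List.cons_append, findStart, if_neg h1, List.foldl_cons]
    exact ih _ h

theorem findStart_append_of_lt {x : ℕ} (l₁ l₂ : List (Bool × Bool)) (st : ℕ × ℕ × ℕ)
    (hst : st.1 ≤ x) (h : x < (l₁.foldl opStep st).1) :
    findStart x st (l₁ ++ l₂) = findStart x st l₁ := by
  induction l₁ generalizing st with
  | nil => exact absurd h (not_lt.2 hst)
  | cons o l ih =>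
    simp only [List.cons_append, findStart]
    split_ifs with h1
    · rfl
    · exact ih _ (not_lt.1 h1) h

theorem foldl_digitOps (p s g : ℕ) : (digitOps g).foldl opStep (p, s, 0) = (p, s, g) := by
  induction g using Nat.strong_induction_on with
  | _ g ih =>
    rw [digitOps]
    split_ifs with h
    · simp [h]
    · rw [List.foldl_append, ih _ (by omega)]
      simp only [List.foldl_cons, List.foldl_nil, opStep]
      congr 2
      rcases Nat.mod_two_eq_zero_or_one g with h1 | h1 <;> simp [h1] <;> omega

/-- The intermediate accumulators are the leading binary digits of `g`, hence at most `g`. Bounded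
states ensure that the arithmetic on words never overflows. -/
theorem statesBounded_digitOps {n p s : ℕ} (hp : p ≤ n) (hs : s ≤ n) (g : ℕ) (hg : g ≤ n) :
    StatesBounded n (p, s, 0) (digitOps g) := by
  induction g using Nat.strong_induction_on with
  | _ g ih =>
    rw [digitOps]
    split_ifs with h
    · exact ⟨hp, hs, Nat.zero_le _⟩
    · rw [statesBounded_append]
      refine ⟨ih _ (by omega) (by omega), ?_⟩
      have h2 := foldl_digitOps p s g
      rw [digitOps, if_neg h, List.foldl_append] at h2
      refine ⟨?_, ?_⟩
      · rw [foldl_digitOps]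
        exact ⟨hp, hs, by show g / 2 ≤ n; omega⟩
      · simp only [List.foldl_cons, List.foldl_nil] at h2
        rw [h2]
        exact ⟨hp, hs, hg⟩

theorem length_digitOps (g : ℕ) : (digitOps g).length = Nat.size g := by
  induction g using Nat.strong_induction_on with
  | _ g ih =>
    rw [digitOps]
    split_ifs with h
    · simp [h]
    · rw [List.length_append, ih _ (by omega), List.length_singleton]
      conv_rhs => rw [← Nat.bit_bodd_div2 g]
      rw [Nat.size_bit (by rwa [Nat.bit_bodd_div2]), Nat.div2_val]

theorem pieceStart_replicate_append {s : ℕ} (m : ℕ) (cs : List ℕ) (x : ℕ) :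
    pieceStart (List.replicate m s ++ cs) x =
      if x < s * m then x - x % s else s * m + pieceStart cs (x - s * m) := by
  induction m generalizing x with
  | zero => simp
  | succ m ih =>
    rw [List.replicate_succ, List.cons_append, pieceStart, ih]
    split_ifs with h1 h2 h3 h4 h5
    · rw [Nat.mod_eq_of_lt h1]; simp
    · rw [mul_add] at h2; omega
    · rw [Nat.mod_eq_sub_mod (not_lt.1 h1)]
      have := Nat.mod_le (x - s) s
      omega
    · rw [mul_add] at h4; omega
    · rw [mul_add] at h5; omega
    · rw [mul_add, mul_one, Nat.sub_sub]
      rw [show s + s * m = s * m + s by ring]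
      ring

theorem foldl_record (p prev s m : ℕ) (h : prev ≤ s) :
    ((digitOps (s - prev) ++ [(true, false)]) ++ (digitOps m ++ [(true, true)])).foldl opStep
      (p, prev, 0) = (p + s * m, s, 0) := by
  simp only [List.foldl_append, foldl_digitOps, List.foldl_cons, List.foldl_nil, opStep,
    Nat.add_sub_cancel' h]

theorem statesBounded_groupOps {n : ℕ} (R : List (ℕ × ℕ)) (p prev : ℕ) (hprev : prev ≤ n)
    (hpos : ∀ g ∈ R, 1 ≤ g.1 ∧ 1 ≤ g.2)
    (hR : (prev :: R.map Prod.fst).Pairwise (· ≤ ·))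
    (hn : p + (R.map fun g => g.1 * g.2).sum ≤ n) :
    StatesBounded n (p, prev, 0) (groupOps prev R) := by
  induction R generalizing p prev with
  | nil => exact ⟨by simpa using hn, hprev, Nat.zero_le _⟩
  | cons g R ih =>
    obtain ⟨s, m⟩ := g
    rw [List.map_cons, List.pairwise_cons] at hR
    rw [List.map_cons, List.sum_cons] at hn
    have hps : prev ≤ s := hR.1 _ (by simp)
    obtain ⟨h1, h2⟩ : 1 ≤ s ∧ 1 ≤ m := hpos (s, m) (by simp)
    have hs : s ≤ s * m := Nat.le_mul_of_pos_right _ h2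
    have hm : m ≤ s * m := Nat.le_mul_of_pos_left _ h1
    dsimp only at hn
    rw [groupOps, statesBounded_append, statesBounded_append, statesBounded_append,
      statesBounded_append, foldl_record _ _ _ _ hps]
    refine ⟨⟨⟨statesBounded_digitOps (by omega) hprev _ (by omega), ?_⟩, ?_, ?_⟩,
      ih _ _ (by omega) (fun g hg => hpos g (by simp [hg])) hR.2 (by omega)⟩
    all_goals
      simp only [List.foldl_append, foldl_digitOps, List.foldl_cons, List.foldl_nil, opStep,
        Nat.add_sub_cancel' hps, StatesBounded]
    · omega
    · exact statesBounded_digitOps (by omega) (by omega) _ (by omega)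
    · omega

/-- The only operation that moves past `x` is the last one of the group of `x`. At that moment the
state holds the start of the group and its class size, so a remainder gives the offset inside the
class. The arbitrary tail `l` leaves room for padding. -/
theorem findStart_groupOps {x : ℕ} (R : List (ℕ × ℕ)) (p prev : ℕ)
    (hR : (prev :: R.map Prod.fst).Pairwise (· ≤ ·)) (hp : p ≤ x)
    (hx : x < p + (R.map fun g => g.1 * g.2).sum) (l : List (Bool × Bool)) :
    findStart x (p, prev, 0) (groupOps prev R ++ l) = p + pieceStart (groupSizes R) (x - p) := by
  induction R generalizing p prev with
  | nil => simp at hx; omega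
  | cons g R ih =>
    obtain ⟨s, m⟩ := g
    rw [List.map_cons, List.pairwise_cons] at hR
    rw [List.map_cons, List.sum_cons] at hx
    have hps : prev ≤ s := hR.1 _ (by simp)
    rw [groupSizes, List.flatMap_cons, ← groupSizes, pieceStart_replicate_append]
    dsimp only at hx ⊢
    by_cases hlt : x < p + s * m
    · rw [if_pos (by omega), groupOps]
      have e : (digitOps (s - prev) ++ [(true, false)]).foldl opStep (p, prev, 0) = (p, s, 0) := by
        simp only [List.foldl_append, foldl_digitOps, List.foldl_cons, List.foldl_nil, opStep,
          Nat.add_sub_cancel' hps]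
      rw [List.append_assoc, List.append_assoc, findStart_append _ _ _ (by rw [e]; exact hp), e,
        List.append_assoc, findStart_append _ _ _ (by rw [foldl_digitOps]; exact hp),
        foldl_digitOps]
      simp only [List.cons_append, List.nil_append, findStart, opStep]
      refine (if_pos hlt).trans ?_
      have := Nat.mod_le (x - p) s
      omega
    · rw [if_neg (by omega), groupOps, List.append_assoc,
        findStart_append _ _ _ (by rw [foldl_record _ _ _ _ hps]; exact not_lt.1 hlt),
        foldl_record _ _ _ _ hps, ih _ _ hR.2 (not_lt.1 hlt) (by omega), add_assoc, Nat.sub_sub]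

theorem pieceStart_zero (cs : List ℕ) (h : ∀ c ∈ cs, 1 ≤ c) : pieceStart cs 0 = 0 := by
  cases cs with
  | nil => rfl
  | cons c cs => exact if_pos (h c (by simp))

/-- This justifies a linear scan that only remembers the last first element seen. -/
theorem pieceStart_succ (cs : List ℕ) (h : ∀ c ∈ cs, 1 ≤ c) (x : ℕ) :
    pieceStart cs (x + 1) = x + 1 ∨ pieceStart cs (x + 1) = pieceStart cs x := by
  induction cs generalizing x with
  | nil => left; rfl
  | cons c cs ih =>
    have hcs : ∀ c ∈ cs, 1 ≤ c := fun c hc => h c (by simp [hc])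
    simp only [pieceStart]
    rcases lt_trichotomy (x + 1) c with h1 | h1 | h1
    · right; rw [if_pos h1, if_pos (by omega)]
    · left; rw [if_neg (by omega), ← h1, Nat.sub_self, pieceStart_zero cs hcs]
    · rw [if_neg (by omega), if_neg (by omega), show x + 1 - c = x - c + 1 by omega]
      rcases ih hcs (x - c) with h2 | h2
      · left; omega
      · right; rw [h2]

/-! ### The length of the operation sequence -/

theorem size_le_logb {g : ℕ} (hg : 1 ≤ g) : (Nat.size g : ℝ) ≤ Real.logb 2 g + 1 := by
  have h1 : Nat.size g - 1 < Nat.size g := by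
    have := Nat.size_pos.2 hg
    omega
  have h2 : 2 ^ (Nat.size g - 1) ≤ g := Nat.lt_size.1 h1
  have h3 : ((Nat.size g - 1 : ℕ) : ℝ) ≤ Real.logb 2 g := by
    rw [Real.le_logb_iff_rpow_le (by norm_num) (by exact_mod_cast hg), Real.rpow_natCast]
    exact_mod_cast h2
  have h4 : Nat.size g = (Nat.size g - 1) + 1 := by omega
  rw [h4]
  push_cast
  linarith

theorem logb_le_two_mul_log {a : ℝ} (ha : 1 ≤ a) : Real.logb 2 a ≤ 2 * Real.log a := by
  have hl : (1 : ℝ) / 2 < Real.log 2 := by linarith [Real.log_two_gt_d9]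
  have := Real.log_nonneg ha
  rw [Real.logb, div_le_iff₀ (by linarith)]
  nlinarith

theorem sum_map_sub_add_const (R : List (ℕ × ℕ)) (a b : ℝ) :
    (R.map fun g => (g.1 : ℝ) - a).sum =
      (R.map fun g => (g.1 : ℝ) - b).sum + R.length * (b - a) := by
  induction R with
  | nil => simp
  | cons g R ih =>
    simp only [List.map_cons, List.sum_cons, List.length_cons, ih]
    push_cast
    ring

/-- Each group costs two marker operations and the binary lengths of its size increment and of its
multiplicity; rounding up accounts for two more. An increment is weighted by the number of groups
from its own onwards, since it contributes to all their sizes; the weighted increments therefore add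
up to the sum of the sizes minus `prev`. -/
theorem length_groupOps_le_log {M : ℝ} (hM : 0 < M) (R : List (ℕ × ℕ)) (prev : ℕ)
    (hpos : ∀ g ∈ R, 1 ≤ g.2) (hR : (prev :: R.map Prod.fst).Pairwise (· < ·)) :
    ((groupOps prev R).length : ℝ) ≤ 4 * R.length +
      2 * ((R.map fun g => (g.1 : ℝ) - prev).sum / M +
        ∑ j ∈ Finset.Icc 1 R.length, Real.log (M / j)) +
      (R.map fun g => Real.logb 2 g.2).sum := by
  induction R generalizing prev with
  | nil => simp [groupOps]
  | cons g R ih =>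
    obtain ⟨s, m⟩ := g
    rw [List.map_cons, List.pairwise_cons] at hR
    have hps : prev < s := hR.1 _ (by simp)
    have hm : 1 ≤ m := hpos (s, m) (by simp)
    have ih := ih s (fun g hg => hpos g (by simp [hg])) hR.2
    have h1 := size_le_logb (show 1 ≤ s - prev by omega)
    have h2 := size_le_logb hm
    have hg : (1 : ℝ) ≤ ((s - prev : ℕ) : ℝ) := by exact_mod_cast (show 1 ≤ s - prev by omega)
    have h3 := logb_le_two_mul_log hg
    -- The weight is the number of groups left, this one included.
    have h4 := log_le_linear (a := ((s - prev : ℕ) : ℝ)) (t := ((R.length + 1 : ℕ) : ℝ))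
      (by linarith) (by positivity) hM
    simp only [groupOps, List.length_append, length_digitOps,
      List.length_cons, List.length_nil, zero_add, List.map_cons, List.sum_cons]
    rw [Finset.sum_Icc_succ_top (by omega), sum_map_sub_add_const R prev s]
    rw [Nat.cast_sub hps.le] at h1 h3 h4
    rw [Nat.cast_add, Nat.cast_add, Nat.cast_add, Nat.cast_add]
    push_cast at h1 h2 h3 h4 ih ⊢
    have e : ((s : ℝ) - prev + ((R.map fun g => (g.1 : ℝ) - s).sum + R.length * (s - prev))) / M =
        (R.map fun g => (g.1 : ℝ) - s).sum / M + (R.length + 1) * (s - prev) / M := by ring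
    rw [e]
    linarith

theorem length_groupOps_le (R : List (ℕ × ℕ)) {n : ℕ} (hn0 : 1 ≤ n)
    (hpos : ∀ g ∈ R, 1 ≤ g.1 ∧ 1 ≤ g.2) (hR : (R.map Prod.fst).Pairwise (· < ·))
    (hn : (R.map fun g => g.1 * g.2).sum = n) :
    ((groupOps 0 R).length : ℝ) ≤ 40 * √(n : ℝ) := by
  have hM : 0 < √(n : ℝ) := Real.sqrt_pos.2 (by exact_mod_cast hn0)
  have h1 := length_groupOps_le_log hM R 0 (fun g hg => (hpos g hg).2)
    (List.pairwise_cons.2 ⟨by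
      intro a ha
      obtain ⟨g, hg, rfl⟩ := List.mem_map.1 ha
      exact (hpos g hg).1, hR⟩)
  have h2 := sum_log_div_le (Finset.Icc 1 R.length) (fun t ht => (Finset.mem_Icc.1 ht).1) hM
  have hsum : ∀ f : ℕ × ℕ → ℝ, (R.map f).sum = ∑ i : Fin R.length, f (R.get i) := by
    intro f
    rw [← List.sum_ofFn]
    conv_lhs => rw [← List.ofFn_get R, List.map_ofFn]
    rfl
  have hsumn : ∀ f : ℕ × ℕ → ℕ, (R.map f).sum = ∑ i : Fin R.length, f (R.get i) := by
    intro f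
    rw [← List.sum_ofFn]
    conv_lhs => rw [← List.ofFn_get R, List.map_ofFn]
    rfl
  have hp : ∀ i, 1 ≤ (R.get i).1 ∧ 1 ≤ (R.get i).2 := fun i => hpos _ (R.get_mem i)
  have hinj : Set.InjOn (fun i : Fin R.length => (R.get i).1)
      ((Finset.univ : Finset (Fin R.length)) : Set (Fin R.length)) := by
    have hnd : (R.map Prod.fst).Nodup := hR.imp fun h => h.ne
    intro i _ j _ hij
    have := List.nodup_iff_injective_get.1 hnd (a₁ := ⟨i, by simp⟩) (a₂ := ⟨j, by simp⟩)
      (by simpa using hij)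
    simpa [Fin.ext_iff] using this
  -- Doubling the multiplicities makes every logarithm at least `1`, so that this one estimate also
  -- bounds the number of groups.
  have h3 := sum_logb_le_sqrt Finset.univ (fun i : Fin R.length => (R.get i).1)
    (fun i => 2 * (R.get i).2) (fun i _ => (hp i).1) (fun i _ => by have := (hp i).2; omega) hinj
    (n := 4 * n) (by
      rw [← hn, hsumn, Finset.mul_sum]
      exact Finset.sum_le_sum fun i _ => by nlinarith [Nat.zero_le ((R.get i).1 * (R.get i).2)])
  have hs4 : √((4 * n : ℕ) : ℝ) = 2 * √(n : ℝ) := by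
    push_cast
    rw [Real.sqrt_mul (by norm_num), show (4 : ℝ) = 2 ^ 2 by norm_num,
      Real.sqrt_sq (by norm_num)]
  rw [hs4] at h3
  have h4 : ∑ i : Fin R.length, Real.logb 2 ((2 * (R.get i).2 : ℕ) : ℝ) =
      R.length + ∑ i : Fin R.length, Real.logb 2 (R.get i).2 := by
    have : ∀ i, Real.logb 2 ((2 * (R.get i).2 : ℕ) : ℝ) = 1 + Real.logb 2 (R.get i).2 := by
      intro i
      have hi : ((R.get i).2 : ℝ) ≠ 0 := by have := (hp i).2; positivity
      push_cast
      rw [Real.logb_mul (by norm_num) hi, Real.logb_self_eq_one (by norm_num)]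
    simp only [this, Finset.sum_add_distrib, Finset.sum_const, Finset.card_univ, Fintype.card_fin,
      nsmul_eq_mul, mul_one]
  have h5 : 0 ≤ ∑ i : Fin R.length, Real.logb 2 (R.get i).2 :=
    Finset.sum_nonneg fun i _ => Real.logb_nonneg (by norm_num) (by exact_mod_cast (hp i).2)
  have h6 : (R.map fun g => (g.1 : ℝ) - (0 : ℕ)).sum / √(n : ℝ) ≤ √(n : ℝ) := by
    rw [div_le_iff₀ hM, Real.mul_self_sqrt (by positivity), hsum, ← hn, hsumn]
    push_cast
    refine Finset.sum_le_sum fun i _ => ?_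
    have : (R.get i).1 ≤ (R.get i).1 * (R.get i).2 := Nat.le_mul_of_pos_right _ (hp i).2
    rw [sub_zero]
    exact_mod_cast this
  rw [hsum fun g => Real.logb 2 g.2] at h1
  linarith

/-! ### Labeling the elements class by class -/

/-- In the concatenation of the classes, a position lies in the first piece exactly when its element
is in the first class. A later position yields a start of at least the length of that piece, which
is positive as soon as the class contains an element. -/
theorem pieceStart_idxOf_eq_iff {α β : Type*} [DecidableEq α] (f : α → β) (cls : β → List α)
    (hcls : ∀ x b, x ∈ cls b ↔ f x = b) (bs : List β) (x y : α) (hx : f x ∈ bs) (hy : f y ∈ bs) :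
    pieceStart (bs.map fun b => (cls b).length) ((bs.flatMap cls).idxOf x) =
      pieceStart (bs.map fun b => (cls b).length) ((bs.flatMap cls).idxOf y) ↔ f x = f y := by
  induction bs with
  | nil => simp at hx
  | cons b bs ih =>
    have key : ∀ z, f z ∈ b :: bs → (f z = b ∧
        pieceStart ((b :: bs).map fun b => (cls b).length) (((b :: bs).flatMap cls).idxOf z) = 0) ∨
        (f z ≠ b ∧ f z ∈ bs ∧
        pieceStart ((b :: bs).map fun b => (cls b).length) (((b :: bs).flatMap cls).idxOf z) =
          (cls b).length +
            pieceStart (bs.map fun b => (cls b).length) ((bs.flatMap cls).idxOf z)) := by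
      intro z hz
      rw [List.flatMap_cons, List.map_cons, List.idxOf_append, pieceStart]
      by_cases h : f z = b
      · left
        have hm := (hcls z b).2 h
        rw [if_pos hm, if_pos (List.idxOf_lt_length_iff.2 hm)]
        exact ⟨h, rfl⟩
      · right
        have hm : z ∉ cls b := fun hm => h ((hcls z b).1 hm)
        rw [if_neg hm, if_neg (by omega), Nat.add_sub_cancel]
        exact ⟨h, (List.mem_cons.1 hz).resolve_left h, rfl⟩
    have hlen : ∀ z, f z = b → 0 < (cls b).length := fun z hz =>
      List.length_pos_of_mem ((hcls z b).2 hz)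
    rcases key x hx with ⟨h1, h2⟩ | ⟨h1, h2, h3⟩ <;> rcases key y hy with ⟨h4, h5⟩ | ⟨h4, h5, h6⟩
    · rw [h2, h5, h1, h4]; simp
    · have := hlen x h1
      rw [h2, h6, h1]
      exact ⟨fun h => by omega, fun h => absurd h.symm h4⟩
    · have := hlen y h4
      rw [h3, h5, h4]
      exact ⟨fun h => by omega, fun h => absurd h h1⟩
    · rw [h3, h6, Nat.add_left_cancel_iff]
      exact ih h2 h5

theorem isLabeling_idxOf {α : Type u} [Fintype α] [DecidableEq α] (l : List α) (hnd : l.Nodup)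
    (hmem : ∀ x, x ∈ l) : IsLabeling fun x => l.idxOf x + 1 := by
  have hlen : l.length = Fintype.card α := by
    rw [← List.toFinset_card_of_nodup hnd, ← Finset.card_univ]
    congr 1
    ext x
    simp [hmem]
  refine ⟨fun x _ => ?_, fun x _ y _ h => ?_, fun j hj => ?_⟩
  · have := List.idxOf_lt_length_iff.2 (hmem x)
    simp only [Set.mem_Icc]
    omega
  · exact (List.idxOf_inj (hmem x)).1 (Nat.succ_injective h)
  · rw [Set.mem_Icc] at hj
    refine ⟨l[j - 1], Set.mem_univ _, ?_⟩
    simp only [hnd.idxOf_getElem]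
    omega

theorem exists_labeling {α : Type u} [Fintype α] (r : Setoid α) :
    ∃ (R : List (ℕ × ℕ)) (label : α → ℕ), (∀ g ∈ R, 1 ≤ g.1 ∧ 1 ≤ g.2) ∧
      (R.map Prod.fst).Pairwise (· < ·) ∧
      (R.map fun g => g.1 * g.2).sum = Fintype.card α ∧ IsLabeling label ∧
      ∀ x y, r x y ↔ pieceStart (groupSizes R) (label x - 1) =
        pieceStart (groupSizes R) (label y - 1) := by
  classical
  let f : α → Quotient r := Quotient.mk r
  let cls (b : Quotient r) : List α := (Finset.univ.filter fun x => f x = b).toList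
  have hcls : ∀ x b, x ∈ cls b ↔ f x = b := by intro x b; simp [cls]
  let ofSize (s : ℕ) : List (Quotient r) :=
    (Finset.univ.filter fun b => (cls b).length = s).toList
  have hofSize : ∀ b s, b ∈ ofSize s ↔ (cls b).length = s := by intro b s; simp [ofSize]
  -- Keeping only the sizes that occur makes all multiplicities positive, and the range makes the
  -- sizes strictly increasing.
  let S : List ℕ := (List.range (Fintype.card α + 1)).filter fun s => ofSize s ≠ []
  let R : List (ℕ × ℕ) := S.map fun s => (s, (ofSize s).length)
  let bs : List (Quotient r) := S.flatMap ofSize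
  have hS : ∀ s ∈ S, ofSize s ≠ [] := fun s hs => by simpa using (List.mem_filter.1 hs).2
  have hSlt : S.Pairwise (· < ·) := List.Pairwise.filter _ List.pairwise_lt_range
  have hbs : ∀ b, b ∈ bs := by
    intro b
    refine List.mem_flatMap.2 ⟨(cls b).length, List.mem_filter.2 ⟨?_, ?_⟩, (hofSize b _).2 rfl⟩
    · simp only [List.mem_range, cls, Finset.length_toList]
      exact Nat.lt_succ_of_le (Finset.card_le_univ _)
    · simpa using List.ne_nil_of_mem ((hofSize b _).2 rfl)
  have hsizes : groupSizes R = bs.map fun b => (cls b).length := by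
    simp only [groupSizes, R, bs, List.flatMap_map, List.map_flatMap]
    congr 1
    funext s
    symm
    rw [List.map_eq_replicate_iff]
    exact fun b hb => (hofSize b s).1 hb
  have hmem : ∀ x, x ∈ bs.flatMap cls := fun x =>
    List.mem_flatMap.2 ⟨f x, hbs _, (hcls x _).2 rfl⟩
  have hbsnd : bs.Nodup := by
    refine List.nodup_flatMap.2 ⟨fun s _ => Finset.nodup_toList _, hSlt.imp fun {s t} hst => ?_⟩
    intro b hb hb'
    have h1 := (hofSize b s).1 hb
    have h2 := (hofSize b t).1 hb'
    omega
  have hnd : (bs.flatMap cls).Nodup := by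
    refine List.nodup_flatMap.2 ⟨fun s _ => Finset.nodup_toList _, hbsnd.imp fun {s t} hst => ?_⟩
    intro x hx hx'
    exact hst (((hcls x s).1 hx).symm.trans ((hcls x t).1 hx'))
  have hsum : ∀ R : List (ℕ × ℕ), (R.map fun g => g.1 * g.2).sum = (groupSizes R).sum := by
    intro R
    induction R with
    | nil => rfl
    | cons g R ih =>
      rw [groupSizes, List.flatMap_cons, ← groupSizes, List.sum_append, List.sum_replicate,
        List.map_cons, List.sum_cons, ih, smul_eq_mul, mul_comm]
  refine ⟨R, fun x => (bs.flatMap cls).idxOf x + 1, ?_, ?_, ?_, isLabeling_idxOf _ hnd hmem, ?_⟩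
  · intro g hg
    obtain ⟨s, hs, rfl⟩ := List.mem_map.1 hg
    have h1 := List.length_pos_of_ne_nil (hS s hs)
    refine ⟨?_, h1⟩
    obtain ⟨b, hb⟩ := List.exists_mem_of_ne_nil _ (hS s hs)
    obtain ⟨x, rfl⟩ := Quotient.exists_rep b
    rw [← (hofSize _ _).1 hb]
    exact List.length_pos_of_mem ((hcls x _).2 rfl)
  · simpa [R, List.map_map, Function.comp_def] using hSlt
  · rw [hsum, hsizes, ← List.length_flatMap, ← List.toFinset_card_of_nodup hnd,
      ← Finset.card_univ]
    congr 1
    ext x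
    simp only [List.mem_toFinset, hmem, Finset.mem_univ]
  · intro x y
    rw [hsizes, Nat.add_sub_cancel, Nat.add_sub_cancel,
      pieceStart_idxOf_eq_iff f cls hcls bs x y (hbs _) (hbs _)]
    exact Quotient.eq.symm

/-! ### The machine on natural numbers, and rules for reasoning about code -/

namespace WordRAM

/-- The effect of an operation on the numbers that the words represent. -/
def BinOp.evalNat (w : ℕ) : BinOp → ℕ → ℕ → ℕ
  | .add, x, y => (x + y) % 2 ^ w
  | .sub, x, y => (2 ^ w - y + x) % 2 ^ w
  | .mul, x, y => x * y % 2 ^ w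
  | .and, x, y => x &&& y
  | .or, x, y => x ||| y
  | .xor, x, y => x ^^^ y
  | .shl, x, y => x <<< y % 2 ^ w
  | .shr, x, y => x >>> y

theorem BinOp.toNat_eval {w : ℕ} (o : BinOp) (x y : BitVec w) :
    (o.eval x y).toNat = o.evalNat w x.toNat y.toNat := by
  cases o <;> simp [BinOp.eval, BinOp.evalNat]

/-- The effect of an instruction on the program counter and the numbers in the registers. -/
def Instr.execNat (w : ℕ) (mem : ℕ → ℕ) (pc : ℕ) (v : ℕ → ℕ) : Instr → ℕ × (ℕ → ℕ)
  | .const d c => (pc + 1, Function.update v d (c % 2 ^ w))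
  | .op o d a b => (pc + 1, Function.update v d (o.evalNat w (v a) (v b)))
  | .load d a => (pc + 1, Function.update v d (mem (v a)))
  | .jump t => (t, v)
  | .jeq a b t => (if v a = v b then t else pc + 1, v)
  | .jlt a b t => (if v a < v b then t else pc + 1, v)

/-- One step on numbers. -/
def stepNat (w : ℕ) (P : Program) (mem : ℕ → ℕ) (s : ℕ × (ℕ → ℕ)) : ℕ × (ℕ → ℕ) :=
  match P[s.1]? with
  | none => s
  | some i => i.execNat w mem s.1 s.2

/-- The program counter and the numbers in the registers. -/
def Config.toNats {w : ℕ} (s : Config w) : ℕ × (ℕ → ℕ) := (s.pc, fun i => (s.reg i).toNat)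

/-- The memory contents as numbers. -/
def memNat (w : ℕ) (D : List Bool) (a : ℕ) : ℕ := (pack w D (BitVec.ofNat w a)).toNat

/-- All later reasoning about the program takes place on natural numbers; this simulation transfers
it to words. -/
theorem toNats_step {w : ℕ} (P : Program) (D : List Bool) (s : Config w) :
    (step P (pack w D) s).toNats = stepNat w P (memNat w D) s.toNats := by
  have hupd : ∀ (d : ℕ) (x : BitVec w), (fun i => (Function.update s.reg d x i).toNat) =
      Function.update (fun i => (s.reg i).toNat) d x.toNat := by
    intro d x
    funext i
    by_cases h : i = d
    · subst h; simp
    · simp [h]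
  unfold step stepNat
  simp only [Config.toNats]
  cases P[s.pc]? with
  | none => rfl
  | some i =>
    cases i with
    | const d c => simp [Instr.exec, Instr.execNat, hupd]
    | op o d a b => simp [Instr.exec, Instr.execNat, hupd, BinOp.toNat_eval]
    | load d a => simp [Instr.exec, Instr.execNat, hupd, memNat]
    | jump t => rfl
    | jeq a b t => simp [Instr.exec, Instr.execNat, BitVec.toNat_inj]
    | jlt a b t => simp [Instr.exec, Instr.execNat]

theorem toNats_iterate {w : ℕ} (P : Program) (D : List Bool) (s : Config w) (t : ℕ) :
    ((step P (pack w D))^[t] s).toNats = (stepNat w P (memNat w D))^[t] s.toNats := by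
  induction t with
  | zero => rfl
  | succ t ih => rw [Function.iterate_succ_apply', Function.iterate_succ_apply', toNats_step, ih]

theorem testBit_memNat {w : ℕ} (D : List Bool) {a i : ℕ} (ha : a < 2 ^ w) (hi : i < w) :
    (memNat w D a).testBit i = D.getD (a * w + i) false := by
  rw [memNat, BitVec.testBit_toNat, pack, BitVec.getLsbD_ofFnLE, dif_pos hi, BitVec.toNat_ofNat,
    Nat.mod_eq_of_lt ha]

/-- Within `t` steps the machine reaches a state that satisfies `Q`. -/
def Within (w : ℕ) (P : Program) (mem : ℕ → ℕ) (t pc : ℕ) (v : ℕ → ℕ)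
    (Q : ℕ → (ℕ → ℕ) → Prop) : Prop :=
  ∃ t' ≤ t, Q ((stepNat w P mem)^[t'] (pc, v)).1 ((stepNat w P mem)^[t'] (pc, v)).2

section Rules

variable {w : ℕ} {P : Program} {mem : ℕ → ℕ} {t pc : ℕ} {v : ℕ → ℕ} {Q : ℕ → (ℕ → ℕ) → Prop}

theorem Within.done (h : Q pc v) : Within w P mem t pc v Q := ⟨0, Nat.zero_le _, h⟩

theorem Within.mono {t₁ : ℕ} (h : Within w P mem t₁ pc v Q) (ht : t₁ ≤ t) :
    Within w P mem t pc v Q := by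
  obtain ⟨t', h1, h2⟩ := h
  exact ⟨t', h1.trans ht, h2⟩

theorem Within.bind {t₁ t₂ : ℕ} {Q₁ : ℕ → (ℕ → ℕ) → Prop} (h : Within w P mem t₁ pc v Q₁)
    (h' : ∀ pc' v', Q₁ pc' v' → Within w P mem t₂ pc' v' Q) (ht : t₁ + t₂ ≤ t) :
    Within w P mem t pc v Q := by
  obtain ⟨a, ha, h1⟩ := h
  obtain ⟨b, hb, h2⟩ := h' _ _ h1
  refine ⟨b + a, by omega, ?_⟩
  rw [Function.iterate_add_apply]
  exact h2

theorem Within.step {i : Instr} (hP : P[pc]? = some i)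
    (h : Within w P mem t (i.execNat w mem pc v).1 (i.execNat w mem pc v).2 Q) :
    Within w P mem (t + 1) pc v Q := by
  obtain ⟨a, ha, h1⟩ := h
  refine ⟨a + 1, by omega, ?_⟩
  have e : stepNat w P mem (pc, v) = i.execNat w mem pc v := by
    simp only [stepNat, hP]
  rw [Function.iterate_succ_apply, e]
  exact h1

theorem Within.const {d c : ℕ} (x : ℕ) (hP : P[pc]? = some (.const d c)) (hc : c % 2 ^ w = x)
    (h : Within w P mem t (pc + 1) (Function.update v d x) Q) :
    Within w P mem (t + 1) pc v Q :=
  Within.step hP (by rw [← hc] at h; exact h)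

theorem Within.load {d a : ℕ} (y : ℕ) (hP : P[pc]? = some (.load d a)) (ha : v a = y)
    (h : Within w P mem t (pc + 1) (Function.update v d (mem y)) Q) :
    Within w P mem (t + 1) pc v Q :=
  Within.step hP (by rw [← ha] at h; exact h)

theorem Within.add {d a b : ℕ} (x : ℕ) (hP : P[pc]? = some (.op .add d a b))
    (hx : v a + v b = x) (hlt : x < 2 ^ w)
    (h : Within w P mem t (pc + 1) (Function.update v d x) Q) :
    Within w P mem (t + 1) pc v Q :=
  Within.step hP (by
    simp only [Instr.execNat, BinOp.evalNat]
    rwa [hx, Nat.mod_eq_of_lt hlt])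

theorem Within.mul {d a b : ℕ} (x : ℕ) (hP : P[pc]? = some (.op .mul d a b))
    (hx : v a * v b = x) (hlt : x < 2 ^ w)
    (h : Within w P mem t (pc + 1) (Function.update v d x) Q) :
    Within w P mem (t + 1) pc v Q :=
  Within.step hP (by
    simp only [Instr.execNat, BinOp.evalNat]
    rwa [hx, Nat.mod_eq_of_lt hlt])

theorem Within.sub {d a b : ℕ} (x : ℕ) (hP : P[pc]? = some (.op .sub d a b))
    (hx : x + v b = v a) (hlt : v a < 2 ^ w)
    (h : Within w P mem t (pc + 1) (Function.update v d x) Q) :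
    Within w P mem (t + 1) pc v Q :=
  Within.step hP (by
    simp only [Instr.execNat, BinOp.evalNat]
    rwa [show 2 ^ w - v b + v a = 2 ^ w + x by omega, Nat.add_mod_left,
      Nat.mod_eq_of_lt (show x < 2 ^ w by omega)])

/-- A left shift of `1`, possibly out of the word. -/
theorem Within.shl_one {d a b : ℕ} (y : ℕ) (hP : P[pc]? = some (.op .shl d a b))
    (ha : v a = 1) (hb : v b = y)
    (h : Within w P mem t (pc + 1) (Function.update v d (2 ^ y % 2 ^ w)) Q) :
    Within w P mem (t + 1) pc v Q :=
  Within.step hP (by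
    simp only [Instr.execNat, BinOp.evalNat]
    rwa [ha, hb, Nat.one_shiftLeft])

/-- Together with the preceding shift this builds the mask of `y` ones. It is correct even for `y =
w`: the shifted bit is lost, and `0 - 1` wraps around to the word of all ones. -/
theorem Within.sub_one_mod {d a b : ℕ} (y : ℕ) (hP : P[pc]? = some (.op .sub d a b))
    (ha : v a = 2 ^ y % 2 ^ w) (hb : v b = 1) (hy : y ≤ w)
    (h : Within w P mem t (pc + 1) (Function.update v d (2 ^ y - 1)) Q) :
    Within w P mem (t + 1) pc v Q :=
  Within.step hP (by
    simp only [Instr.execNat, BinOp.evalNat]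
    have hpos := Nat.two_pow_pos y
    have e : (2 ^ w - v b + v a) % 2 ^ w = 2 ^ y - 1 := by
      rw [ha, hb]
      rcases hy.lt_or_eq with h1 | rfl
      · have h2 : 2 ^ y < 2 ^ w := Nat.pow_lt_pow_right (by omega) h1
        rw [Nat.mod_eq_of_lt h2, show 2 ^ w - 1 + 2 ^ y = 2 ^ w + (2 ^ y - 1) by omega,
          Nat.add_mod_left, Nat.mod_eq_of_lt (by omega)]
      · rw [Nat.mod_self, add_zero, Nat.mod_eq_of_lt (by omega)]
    rwa [e])

theorem Within.and {d a b : ℕ} (x : ℕ) (hP : P[pc]? = some (.op .and d a b))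
    (hx : v a &&& v b = x) (h : Within w P mem t (pc + 1) (Function.update v d x) Q) :
    Within w P mem (t + 1) pc v Q :=
  Within.step hP (by rw [← hx] at h; exact h)

theorem Within.shr {d a b : ℕ} (x : ℕ) (hP : P[pc]? = some (.op .shr d a b))
    (hx : v a >>> v b = x) (h : Within w P mem t (pc + 1) (Function.update v d x) Q) :
    Within w P mem (t + 1) pc v Q :=
  Within.step hP (by rw [← hx] at h; exact h)

/-- Copying a register by a disjunction with a register that holds `0`. -/
theorem Within.copy {d a b : ℕ} (x : ℕ) (hP : P[pc]? = some (.op .or d a b))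
    (hx : v a = x) (hb : v b = 0) (h : Within w P mem t (pc + 1) (Function.update v d x) Q) :
    Within w P mem (t + 1) pc v Q :=
  Within.step hP (by
    simp only [Instr.execNat, BinOp.evalNat]
    rwa [hb, hx, Nat.or_zero])

theorem Within.jump {t' : ℕ} (hP : P[pc]? = some (.jump t')) (h : Within w P mem t t' v Q) :
    Within w P mem (t + 1) pc v Q :=
  Within.step hP h

theorem Within.jeq {a b t' : ℕ} (hP : P[pc]? = some (.jeq a b t'))
    (h1 : v a = v b → Within w P mem t t' v Q)
    (h2 : v a ≠ v b → Within w P mem t (pc + 1) v Q) : Within w P mem (t + 1) pc v Q :=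
  Within.step hP (by
    simp only [Instr.execNat]
    split_ifs with h
    · exact h1 h
    · exact h2 h)

theorem Within.jlt {a b t' : ℕ} (hP : P[pc]? = some (.jlt a b t'))
    (h1 : v a < v b → Within w P mem t t' v Q)
    (h2 : v b ≤ v a → Within w P mem t (pc + 1) v Q) : Within w P mem (t + 1) pc v Q :=
  Within.step hP (by
    simp only [Instr.execNat]
    split_ifs with h
    · exact h1 h
    · exact h2 (not_lt.1 h))

end Rules

/-! ### Reading bits, unary numbers and slots -/

/-- Code at address `k` that reads the next bit of the memory into register `6`. Registers `4` and
`5` hold the address of the current word and the position in it. -/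
def getBit (k : ℕ) : List Instr :=
  [.load 6 4, .op .shr 6 6 5, .op .and 6 6 3, .op .add 5 5 3, .jlt 5 2 (k + 7), .const 5 0,
    .op .add 4 4 3]

/-- Code at address `k` that reads a number in unary and adds it to register `d`. -/
def readUnary (k d : ℕ) : List Instr :=
  getBit k ++ [.jeq 6 20 (k + 10), .op .add d d 3, .jump k]

/-- Code that reads the slot whose number is in register `17` into register `d`. -/
def readSlot (d : ℕ) : List Instr :=
  [.op .shr d 17 9, .load d d, .op .and 28 17 11, .op .mul 28 28 8, .op .shr d d 28,
    .op .and d d 12]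

/-- The code `code` stands at address `k` of the program `P`. -/
def CodeAt (P : Program) (k : ℕ) (code : List Instr) : Prop :=
  ∀ (i : ℕ) (x : Instr), code[i]? = some x → P[k + i]? = some x

theorem CodeAt.append_left {P : Program} {k : ℕ} {code code' : List Instr}
    (h : CodeAt P k (code ++ code')) : CodeAt P k code := fun i x hi =>
  h i x (by rw [List.getElem?_append_left (List.getElem?_eq_some_iff.1 hi).1, hi])

theorem CodeAt.append_right {P : Program} {k : ℕ} {code code' : List Instr}
    (h : CodeAt P k (code ++ code')) : CodeAt P (k + code.length) code' := fun i x hi => by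
  rw [add_assoc]
  refine h _ x ?_
  rw [List.getElem?_append_right (Nat.le_add_right _ _), Nat.add_sub_cancel_left, hi]

/-- Quotient and remainder of the bit position by `w` are maintained in two registers, because the
machine cannot divide. The bound on `pos` keeps the next address inside a word. -/
theorem within_getBit {w : ℕ} {P : Program} {D : List Bool} {k : ℕ} (hP : CodeAt P k (getBit k))
    {v : ℕ → ℕ} {pos : ℕ} (hw : 1 ≤ w) (h2 : v 2 = w) (h3 : v 3 = 1) (h4 : v 4 = pos / w)
    (h5 : v 5 = pos % w) (hpos : pos + 1 < w * 2 ^ w) :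
    Within w P (memNat w D) 7 k v fun pc v' => pc = k + 7 ∧ v' 6 = (D.getD pos false).toNat ∧
      v' 4 = (pos + 1) / w ∧ v' 5 = (pos + 1) % w ∧
      ∀ i, i ≠ 4 → i ≠ 5 → i ≠ 6 → v' i = v i := by
  have hdiv : pos / w < 2 ^ w := Nat.div_lt_of_lt_mul (by omega)
  have hdiv' : (pos + 1) / w < 2 ^ w := Nat.div_lt_of_lt_mul hpos
  have hmod : pos % w < w := Nat.mod_lt _ hw
  have hww : w < 2 ^ w := Nat.lt_two_pow_self
  have hbit : memNat w D (pos / w) >>> (pos % w) &&& 1 = (D.getD pos false).toNat := by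
    have h := testBit_memNat (w := w) D hdiv hmod
    rw [Nat.div_add_mod' pos w] at h
    rw [← h, Nat.and_one_is_mod, Nat.testBit_eq_decide_div_mod_eq, Nat.shiftRight_eq_div_pow]
    rcases Nat.mod_two_eq_zero_or_one (memNat w D (pos / w) / 2 ^ (pos % w)) with h | h <;> simp [h]
  have hdm := Nat.div_add_mod pos w
  refine Within.load (pos / w) (hP 0 _ rfl) h4 ?_
  refine Within.shr _ (hP 1 _ rfl) rfl ?_
  refine Within.and (D.getD pos false).toNat (hP 2 _ rfl) ?_ ?_
  · simp [h5, h3, hbit]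
  refine Within.add (pos % w + 1) (hP 3 _ rfl) ?_ (by omega) ?_
  · simp [h5, h3]
  refine Within.jlt (hP 4 _ rfl) (fun h => ?_) (fun h => ?_)
  · simp only [Function.update_apply, h2] at h
    refine Within.done ⟨rfl, by simp, ?_, ?_, ?_⟩
    · simp only [Function.update_apply, h4]
      symm
      refine Nat.div_eq_of_lt_le ?_ ?_
      · simp; nlinarith
      · simp at h ⊢; nlinarith
    · simp at h
      simp
      rw [Nat.add_mod, Nat.mod_eq_of_lt (show 1 < w by omega), Nat.mod_eq_of_lt h]
    · intro i hi4 hi5 hi6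
      simp [hi5, hi6]
  · simp only [Function.update_apply, h2] at h
    simp at h
    -- The word is used up: the position returns to `0` and the address advances.
    have hm : pos % w + 1 = w := by omega
    have he : pos + 1 = w * (pos / w + 1) := by rw [mul_add, mul_one]; omega
    refine Within.const 0 (hP 5 _ rfl) (Nat.zero_mod _) ?_
    refine Within.add (pos / w + 1) (hP 6 _ rfl) ?_ ?_ ?_
    · simp [h4, h3]
    · rw [he, Nat.mul_div_cancel_left _ hw] at hdiv'
      exact hdiv'
    refine Within.done ⟨rfl, by simp, ?_, ?_, ?_⟩
    · rw [he, Nat.mul_div_cancel_left _ hw]; simp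
    · rw [he, Nat.mul_mod_right]; simp
    · intro i hi4 hi5 hi6
      simp [hi4, hi5, hi6]

theorem within_readUnary {w : ℕ} {P : Program} {D : List Bool} {k d : ℕ}
    (hP : CodeAt P k (readUnary k d)) (hw : 1 ≤ w)
    (hd : d ≠ 2 ∧ d ≠ 3 ∧ d ≠ 4 ∧ d ≠ 5 ∧ d ≠ 6 ∧ d ≠ 20) (m : ℕ) :
    ∀ (v : ℕ → ℕ) (pos : ℕ), v 2 = w → v 3 = 1 → v 20 = 0 → v 4 = pos / w →
    v 5 = pos % w → pos + m + 1 < w * 2 ^ w → v d + m < 2 ^ w →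
    (∀ i < m, D.getD (pos + i) false = true) → D.getD (pos + m) false = false →
    Within w P (memNat w D) (10 * m + 10) k v fun pc v' => pc = k + 10 ∧
      v' d = v d + m ∧ v' 4 = (pos + m + 1) / w ∧ v' 5 = (pos + m + 1) % w ∧
      ∀ i, i ≠ 4 → i ≠ 5 → i ≠ 6 → i ≠ d → v' i = v i := by
  obtain ⟨hd2, hd3, hd4, hd5, hd6, hd20⟩ := hd
  have hget : CodeAt P k (getBit k) := hP.append_left
  induction m with
  | zero =>
    intro v pos h2 h3 h20 h4 h5 hpos hvd _ hfalse
    refine Within.bind (within_getBit hget hw h2 h3 h4 h5 hpos) ?_ (t₂ := 1) (by omega)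
    rintro _ v' ⟨rfl, h6', h4', h5', hf⟩
    rw [add_zero] at hfalse
    rw [hfalse] at h6'
    refine Within.jeq (hP 7 _ rfl) (fun _ => Within.done ?_) (fun h => ?_)
    · exact ⟨rfl, by rw [hf d hd4 hd5 hd6, add_zero], h4', h5',
        fun i a b c _ => hf i a b c⟩
    · rw [hf 20 (by decide) (by decide) (by decide), h20] at h
      exact absurd h6' h
  | succ m ih =>
    intro v pos h2 h3 h20 h4 h5 hpos hvd htrue hfalse
    refine Within.bind (within_getBit hget hw h2 h3 h4 h5 (by omega)) ?_ (t₂ := 10 * m + 13)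
      (by omega)
    rintro _ v' ⟨rfl, h6', h4', h5', hf⟩
    have ht := htrue 0 (by omega)
    rw [add_zero] at ht
    rw [ht] at h6'
    refine Within.jeq (hP 7 _ rfl) (fun h => ?_) (fun _ => ?_)
    · rw [hf 20 (by decide) (by decide) (by decide), h20, h6'] at h
      exact absurd h (by decide)
    refine Within.add (v d + 1) (hP 8 _ rfl) ?_ (by omega) ?_
    · rw [hf d hd4 hd5 hd6, hf 3 (by decide) (by decide) (by decide), h3]
    refine Within.jump (hP 9 _ rfl) ?_
    have hu : ∀ i, i ≠ d → Function.update v' d (v d + 1) i = v' i := fun i hi => by simp [hi]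
    refine Within.bind (ih (Function.update v' d (v d + 1)) (pos + 1) ?_ ?_ ?_ ?_ ?_ (by omega) ?_ ?_ ?_)
      ?_ (t₂ := 0) (by omega)
    · rw [hu 2 hd2.symm, hf 2 (by decide) (by decide) (by decide), h2]
    · rw [hu 3 hd3.symm, hf 3 (by decide) (by decide) (by decide), h3]
    · rw [hu 20 hd20.symm, hf 20 (by decide) (by decide) (by decide), h20]
    · rw [hu 4 hd4.symm, h4']
    · rw [hu 5 hd5.symm, h5']
    · simp; omega
    · intro i hi
      rw [show pos + 1 + i = pos + (i + 1) by omega]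
      exact htrue (i + 1) (by omega)
    · rw [show pos + 1 + m = pos + (m + 1) by omega]
      exact hfalse
    · rintro _ v'' ⟨rfl, hd'', h4'', h5'', hf''⟩
      rw [show pos + 1 + m = pos + (m + 1) by omega] at h4'' h5''
      refine Within.done ⟨rfl, ?_, h4'', h5'', fun i a b c e => ?_⟩
      · rw [hd'']; simp; omega
      · rw [hf'' i a b c e, hu i e, hf i a b c]

/-- As a word holds `2 ^ q` slots, a shift by `q` yields the address and a mask yields the index
within the word; multiplication by `L` turns the index into a bit offset. -/
theorem within_readSlot {w : ℕ} {P : Program} {mem : ℕ → ℕ} {k d : ℕ}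
    (hP : CodeAt P k (readSlot d)) {v : ℕ → ℕ} {j q L : ℕ} (x : ℕ)
    (hd : d ≠ 8 ∧ d ≠ 11 ∧ d ≠ 12 ∧ d ≠ 17 ∧ d ≠ 28)
    (h17 : v 17 = j) (h9 : v 9 = q) (h11 : v 11 = 2 ^ q - 1) (h8 : v 8 = L)
    (h12 : v 12 = 2 ^ L - 1) (hlt : j % 2 ^ q * L < 2 ^ w)
    (hx : mem (j / 2 ^ q) >>> (j % 2 ^ q * L) % 2 ^ L = x) :
    Within w P mem 6 k v fun pc v' => pc = k + 6 ∧ v' d = x ∧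
      ∀ i, i ≠ 28 → i ≠ d → v' i = v i := by
  obtain ⟨hd8, hd11, hd12, hd17, hd28⟩ := hd
  refine Within.shr (j / 2 ^ q) (hP 0 _ rfl) ?_ ?_
  · rw [h17, h9, Nat.shiftRight_eq_div_pow]
  refine Within.load (j / 2 ^ q) (hP 1 _ rfl) (by simp) ?_
  refine Within.and (j % 2 ^ q) (hP 2 _ rfl) ?_ ?_
  · simp [hd11.symm, hd17.symm, h17, h11, Nat.and_two_pow_sub_one_eq_mod]
  refine Within.mul (j % 2 ^ q * L) (hP 3 _ rfl) ?_ hlt ?_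
  · simp [hd8.symm, h8]
  refine Within.shr (mem (j / 2 ^ q) >>> (j % 2 ^ q * L)) (hP 4 _ rfl) ?_ ?_
  · simp [hd28]
  refine Within.and x (hP 5 _ rfl) ?_ ?_
  · rw [← hx, ← Nat.and_two_pow_sub_one_eq_mod]
    simp [hd12.symm, h12]
  refine Within.done ⟨rfl, by simp, fun i a b => ?_⟩
  simp [a, b]

end WordRAM

/-! ### The query program -/

namespace WordRAM

/-- Code at address `0`: reads the mode and, for the main data structure, its parameters. -/
def headerCode : List Instr :=
  [.const 3 1] ++ (getBit 1 ++ ([.op .or 7 6 20, .jeq 7 20 46] ++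
  (readUnary 10 8 ++ (readUnary 20 9 ++ (readUnary 30 10 ++
  [.op .shl 11 3 9, .op .sub 11 11 3, .op .shl 12 3 8, .op .sub 12 12 3, .const 13 5,
    .op .shl 10 3 10])))))

/-- Code at address `46`: branches according to the mode, initializes the binary search. -/
def entryCode : List Instr :=
  [.op .sub 0 0 3, .jeq 7 20 129, .op .or 14 10 20, .op .or 15 3 20]

/-- Code at address `50`: binary search for the block that contains the element. -/
def searchCode : List Instr :=
  [.jeq 14 3 63, .op .shr 14 14 3, .op .add 16 15 14, .op .mul 17 16 13] ++ (readSlot 18 ++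
  [.jlt 0 18 50, .op .or 15 16 20, .jump 50])

/-- Code at address `63`: reads the five slots of the block. -/
def loadCode : List Instr :=
  [.op .mul 17 15 13] ++ (readSlot 18 ++ ([.op .add 17 17 3] ++ (readSlot 19 ++
  ([.op .add 17 17 3] ++ (readSlot 21 ++ ([.op .add 17 17 3] ++ (readSlot 22 ++
  ([.op .add 17 17 3] ++ readSlot 23))))))))

/-- Code at address `98`: runs the operations of the block until the element is passed. -/
def opsCode : List Instr :=
  [.op .and 24 22 3, .op .and 25 23 3, .op .shr 22 22 3, .op .shr 23 23 3, .jeq 24 3 106,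
    .op .add 21 21 21, .op .add 21 21 25, .jump 98,
    .jeq 25 3 110, .op .add 19 19 21, .const 21 0, .jump 98,
    .op .mul 24 19 21, .op .add 24 18 24, .const 21 0, .jlt 0 24 116, .op .or 18 24 20, .jump 98]

/-- Code at address `116`: division with remainder by shifts and subtractions. -/
def divisionCode : List Instr :=
  [.op .sub 18 0 18, .op .or 21 19 20,
    .op .shr 24 18 3, .jlt 24 21 122, .op .add 21 21 21, .jump 118,
    .jlt 18 21 124, .op .sub 18 18 21, .jeq 21 19 127, .op .shr 21 21 3, .jump 122,
    .op .sub 0 0 18, .jump 145]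

/-- Code at address `129`: the first element of a class from the characteristic sequence of the
first elements. -/
def scanCode : List Instr :=
  [.const 4 0, .const 5 1, .const 8 0] ++ (getBit 132 ++
  [.jeq 6 20 141, .op .or 9 8 20, .jeq 8 0 144, .op .add 8 8 3, .jump 132, .op .or 0 9 20])

/-- Code at address `145`: treats the second element of the query in the same way, and compares. -/
def answerCode : List Instr :=
  [.jeq 26 3 150, .op .or 26 3 20, .op .or 27 0 20, .op .or 0 1 20, .jump 46,
    .jeq 0 27 153, .const 0 0, .jump 154, .const 0 1]

/-- The program that answers the queries. -/
def queryProgram : Program :=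
  headerCode ++ (entryCode ++ (searchCode ++ (loadCode ++ (opsCode ++ (divisionCode ++
    (scanCode ++ answerCode))))))

theorem length_queryProgram : queryProgram.length = 154 := by
  simp [queryProgram, headerCode, entryCode, searchCode, loadCode, opsCode, divisionCode, scanCode,
    answerCode, getBit, readUnary, readSlot]

theorem codeAt_queryProgram : CodeAt queryProgram 0 headerCode ∧ CodeAt queryProgram 46 entryCode ∧
    CodeAt queryProgram 50 searchCode ∧ CodeAt queryProgram 63 loadCode ∧
    CodeAt queryProgram 98 opsCode ∧ CodeAt queryProgram 116 divisionCode ∧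
    CodeAt queryProgram 129 scanCode ∧ CodeAt queryProgram 145 answerCode := by
  have h0 : CodeAt queryProgram 0 queryProgram := fun i x hi => by rwa [zero_add]
  have h1 := h0.append_right
  have h2 := h1.append_right
  have h3 := h2.append_right
  have h4 := h3.append_right
  have h5 := h4.append_right
  have h6 := h5.append_right
  exact ⟨h0.append_left, h1.append_left, h2.append_left, h3.append_left, h4.append_left,
    h5.append_left, h6.append_left, h6.append_right⟩

/-! ### Correctness of the parts of the program -/

section Program

variable {w : ℕ} {mem : ℕ → ℕ} {P : Program}

/-- Comparing half of `r` with the multiple, instead of `r` with its double, avoids overflow: the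
double is formed only when it is at most `r`. -/
theorem within_double (hP : CodeAt P 116 divisionCode) {r s : ℕ} (hr : r < 2 ^ w) (k : ℕ) :
    ∀ (v : ℕ → ℕ) (i : ℕ), v 3 = 1 → v 18 = r → v 21 = s * 2 ^ i → r < s * 2 ^ i * 2 ^ k →
    Within w P mem (4 * k + 2) 118 v fun pc v' => pc = 122 ∧
      (∃ j ≤ i + k, v' 21 = s * 2 ^ j ∧ r < 2 * (s * 2 ^ j)) ∧
      ∀ i, i ≠ 21 → i ≠ 24 → v' i = v i := by
  induction k with
  | zero =>
    intro v i h3 h18 h21 hlt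
    refine Within.shr (r / 2) (hP 2 _ rfl) (by rw [h18, h3, Nat.shiftRight_one]) ?_
    refine Within.jlt (hP 3 _ rfl) (fun _ => Within.done ?_) (fun h => ?_)
    · refine ⟨rfl, ⟨i, by omega, by simp [h21], by omega⟩, fun i a b => by simp [b]⟩
    · simp [h21] at h
      omega
  | succ k ih =>
    intro v i h3 h18 h21 hlt
    rw [show 4 * (k + 1) + 2 = 4 * k + 2 + 1 + 1 + 1 + 1 by ring]
    refine Within.shr (r / 2) (hP 2 _ rfl) (by rw [h18, h3, Nat.shiftRight_one]) ?_
    refine Within.jlt (hP 3 _ rfl) (fun h => Within.done ?_) (fun h => ?_)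
    · simp [h21] at h
      refine ⟨rfl, ⟨i, by omega, by simp [h21], by omega⟩, fun i a b => by simp [b]⟩
    · simp [h21] at h
      refine Within.add (s * 2 ^ (i + 1)) (hP 4 _ rfl) ?_ ?_ (Within.jump (hP 5 _ rfl) ?_)
      · simp [h21]; ring
      · have : s * 2 ^ (i + 1) = 2 * (s * 2 ^ i) := by ring
        omega
      · refine Within.bind (ih _ (i + 1) ?_ ?_ ?_ ?_) ?_ (t₂ := 0) (by omega)
        · simp [h3]
        · simp [h18]
        · simp
        · calc r < _ := hlt
            _ = _ := by ring
        · rintro _ v' ⟨rfl, ⟨j, hj, h1, h2⟩, hf⟩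
          refine Within.done ⟨rfl, ⟨j, by omega, h1, h2⟩, fun i a b => ?_⟩
          rw [hf i a b]
          simp [a, b]

/-- The invariant is `r < 2 * (s * 2 ^ j)`: one conditional subtraction brings `r` below `s * 2 ^
j`, which is the invariant for `j - 1`, and at `j = 0` leaves the remainder. -/
theorem within_reduce (hP : CodeAt P 116 divisionCode) {s : ℕ} (hs : 1 ≤ s) (j : ℕ) :
    ∀ (v : ℕ → ℕ) (r : ℕ), v 3 = 1 → v 18 = r → v 19 = s → v 21 = s * 2 ^ j →
    r < 2 * (s * 2 ^ j) → r < 2 ^ w →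
    Within w P mem (5 * j + 3) 122 v fun pc v' => pc = 127 ∧ v' 18 = r % s ∧
      ∀ i, i ≠ 18 → i ≠ 21 → v' i = v i := by
  have key : ∀ (t : ℕ) (v : ℕ → ℕ) (j r : ℕ) (Q : ℕ → (ℕ → ℕ) → Prop), v 18 = r →
      v 21 = s * 2 ^ j → r < 2 * (s * 2 ^ j) → r < 2 ^ w →
      (∀ v' r', v' 18 = r' → r' < s * 2 ^ j → r' % s = r % s → r' < 2 ^ w →
        (∀ i, i ≠ 18 → v' i = v i) → Within w P mem t 124 v' Q) →
      Within w P mem (t + 2) 122 v Q := by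
    intro t v j r Q h18 h21 hlt hw h
    refine Within.jlt (hP 6 _ rfl) (fun h1 => ?_) (fun h1 => ?_)
    · rw [h18, h21] at h1
      exact (h v r h18 h1 rfl hw fun i _ => rfl).mono (by omega)
    · rw [h18, h21] at h1
      refine Within.sub (r - s * 2 ^ j) (hP 7 _ rfl) (by rw [h18, h21]; omega) (by rw [h18]; exact hw) ?_
      refine h _ (r - s * 2 ^ j) (by simp) (by omega) ?_ (by omega) fun i hi => by simp [hi]
      exact (Nat.sub_mul_mod (by omega))
  induction j with
  | zero =>
    intro v r h3 h18 h19 h21 hlt hw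
    refine key 1 v 0 r _ h18 h21 hlt hw fun v' r' h18' hr' hmod hw' hf => ?_
    refine Within.jeq (hP 8 _ rfl) (fun _ => Within.done ⟨rfl, ?_, fun i a _ => hf i a⟩) (fun h => ?_)
    · rw [h18', ← hmod, Nat.mod_eq_of_lt (by simpa using hr')]
    · rw [hf 21 (by decide), hf 19 (by decide), h21, h19, pow_zero, mul_one] at h
      exact absurd rfl h
  | succ j ih =>
    intro v r h3 h18 h19 h21 hlt hw
    have h2 : s * 2 ^ (j + 1) = 2 * (s * 2 ^ j) := by ring
    rw [show 5 * (j + 1) + 3 = 5 * j + 3 + 1 + 1 + 1 + 2 by ring]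
    refine key _ v (j + 1) r _ h18 h21 hlt hw fun v' r' h18' hr' hmod hw' hf => ?_
    refine Within.jeq (hP 8 _ rfl) (fun h => ?_) (fun _ => ?_)
    · rw [hf 21 (by decide), hf 19 (by decide), h21, h19] at h
      have : 1 < 2 ^ (j + 1) := Nat.one_lt_two_pow (by omega)
      nlinarith
    refine Within.shr (s * 2 ^ j) (hP 9 _ rfl) ?_ (Within.jump (hP 10 _ rfl) ?_)
    · rw [hf 21 (by decide), hf 3 (by decide), h21, h3, Nat.shiftRight_one, pow_succ,
        ← mul_assoc, Nat.mul_div_cancel _ (by decide)]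
    refine Within.bind (ih _ r' ?_ ?_ ?_ ?_ ?_ hw') ?_ (t₂ := 0) (by omega)
    · simp [hf, h3]
    · simp [h18']
    · simp [hf, h19]
    · simp
    · omega
    · rintro _ v'' ⟨rfl, h1, hf'⟩
      refine Within.done ⟨rfl, by rw [h1, hmod], fun i a b => ?_⟩
      rw [hf' i a b, Function.update_of_ne b, hf i a]

theorem testBit_zero_toNat (U : ℕ) : U &&& 1 = (U.testBit 0).toNat := by
  rw [Nat.and_one_is_mod, Nat.testBit_zero]
  rcases Nat.mod_two_eq_zero_or_one U with h | h <;> simp [h]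

/-- The bit planes are shifted right once per operation, so the current operation is always in the
lowest bits. The run stops before the state is advanced past `x`; the start and class size of the
group of `x` are then still in registers `18` and `19`. -/
theorem within_ops (hP : CodeAt P 98 opsCode) {x n : ℕ} (hn : n < 2 ^ w) (seg : List (Bool × Bool)) :
    ∀ (v : ℕ → ℕ) (p s c : ℕ), v 0 = x → v 3 = 1 → v 20 = 0 → v 18 = p → v 19 = s → v 21 = c →
    (∀ i (h : i < seg.length), (v 22).testBit i = seg[i].1 ∧ (v 23).testBit i = seg[i].2) →
    StatesBounded n (p, s, c) seg → p ≤ x → x < (seg.foldl opStep (p, s, c)).1 →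
    Within w P mem (12 * seg.length) 98 v fun pc v' => pc = 116 ∧
      (v' 18 ≤ x ∧ 1 ≤ v' 19 ∧ findStart x (p, s, c) seg = x - (x - v' 18) % v' 19) ∧
      ∀ i, i ≤ 17 ∨ i = 20 ∨ 26 ≤ i → v' i = v i := by
  induction seg with
  | nil =>
    intro v p s c _ _ _ _ _ _ _ _ h1 h2
    exact absurd h2 (not_lt.2 h1)
  | cons o seg ih =>
    intro v p s c h0 h3 h20 h18 h19 h21 hbits hbd hp hx
    obtain ⟨hU, hV⟩ := hbits 0 (by simp)
    simp only [List.getElem_cons_zero] at hU hV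
    have hsh : ∀ i (h : i < seg.length),
        (v 22 >>> 1).testBit i = seg[i].1 ∧ (v 23 >>> 1).testBit i = seg[i].2 := by
      intro i hi
      have := hbits (i + 1) (by simpa using hi)
      rw [List.getElem_cons_succ] at this
      rwa [Nat.testBit_shiftRight, Nat.testBit_shiftRight, add_comm]
    have hst := hbd.2.head
    rw [List.foldl_cons] at hx
    rw [List.length_cons, show 12 * (seg.length + 1) = 12 * seg.length + 7 + 1 + 1 + 1 + 1 + 1 by ring]
    refine Within.and o.1.toNat (hP 0 _ rfl) (by rw [h3, testBit_zero_toNat, hU]) ?_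
    refine Within.and o.2.toNat (hP 1 _ rfl) (by
      rw [Function.update_of_ne (by decide), Function.update_of_ne (by decide), h3,
        testBit_zero_toNat, hV]) ?_
    refine Within.shr (v 22 >>> 1) (hP 2 _ rfl) (by simp [h3]) ?_
    refine Within.shr (v 23 >>> 1) (hP 3 _ rfl) (by simp [h3]) ?_
    obtain ⟨_ | _, b⟩ := o
    · refine Within.jeq (hP 4 _ rfl) (fun h => ?_) (fun _ => ?_)
      · simp [h3] at h
      have hc : 2 * c + b.toNat ≤ n := hst.2.2
      refine Within.mono (t₁ := 12 * seg.length + 1 + 1 + 1) ?_ (by omega)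
      refine Within.add (2 * c) (hP 5 _ rfl) (by simp [h21]; ring) (by omega) ?_
      refine Within.add (2 * c + b.toNat) (hP 6 _ rfl) (by simp) (by omega) (Within.jump (hP 7 _ rfl) ?_)
      refine Within.bind (ih _ p s (2 * c + b.toNat) (by simp [h0]) (by simp [h3]) (by simp [h20])
        (by simp [h18]) (by simp [h19]) (by simp) (by simpa using hsh) hbd.2 hp hx) ?_
        (t₂ := 0) (by omega)
      rintro _ v' ⟨rfl, ⟨h1, h2, h4⟩, hf⟩
      refine Within.done ⟨rfl, ⟨h1, h2, ?_⟩, fun i hi => ?_⟩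
      · rw [← h4]
        exact if_neg (not_lt.2 hp)
      · rw [hf i hi]
        simp (disch := omega) only [Function.update_of_ne]
    · refine Within.jeq (hP 4 _ rfl) (fun _ => ?_) (fun h => ?_)
      swap
      · simp [h3] at h
      obtain _ | _ := b
      · refine Within.mono (t₁ := 12 * seg.length + 1 + 1 + 1 + 1) ?_ (by omega)
        refine Within.jeq (hP 8 _ rfl) (fun h => ?_) (fun _ => ?_)
        · simp [h3] at h
        have hc : s + c ≤ n := hst.2.1
        refine Within.add (s + c) (hP 9 _ rfl) (by simp [h21, h19]) (by omega) ?_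
        refine Within.const 0 (hP 10 _ rfl) (Nat.zero_mod _) (Within.jump (hP 11 _ rfl) ?_)
        refine Within.bind (ih _ p (s + c) 0 (by simp [h0]) (by simp [h3]) (by simp [h20])
          (by simp [h18]) (by simp) (by simp) (by simpa using hsh) hbd.2 hp hx) ?_
          (t₂ := 0) (by omega)
        rintro _ v' ⟨rfl, ⟨h1, h2, h4⟩, hf⟩
        refine Within.done ⟨rfl, ⟨h1, h2, ?_⟩, fun i hi => ?_⟩
        · rw [← h4]
          exact if_neg (not_lt.2 hp)
        · rw [hf i hi]
          simp (disch := omega) only [Function.update_of_ne]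
      · refine Within.jeq (hP 8 _ rfl) (fun _ => ?_) (fun h => ?_)
        swap
        · simp [h3] at h
        have hc : p + s * c ≤ n := hst.1
        refine Within.mul (s * c) (hP 12 _ rfl) (by simp [h21, h19]) (by omega) ?_
        refine Within.add (p + s * c) (hP 13 _ rfl) (by simp [h18]) (by omega) ?_
        refine Within.const 0 (hP 14 _ rfl) (Nat.zero_mod _) ?_
        refine Within.jlt (hP 15 _ rfl) (fun h => ?_) (fun h => ?_)
        · simp [h0] at h
          refine Within.done ⟨rfl, ⟨by simpa [h18] using hp, ?_, ?_⟩, fun i hi => ?_⟩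
          -- A zero class size would leave the position at `p ≤ x`, so that `x` could not have been
          -- passed.
          · simp [h19]
            by_contra hs
            rw [show s = 0 by omega, zero_mul] at h
            omega
          · refine (if_pos h).trans ?_
            simp [h18, h19]
          · simp (disch := omega) only [Function.update_of_ne]
        · simp [h0] at h
          refine Within.copy (p + s * c) (hP 16 _ rfl) (by simp) (by simp [h20]) (Within.jump (hP 17 _ rfl) ?_)
          refine Within.bind (ih _ (p + s * c) s 0 (by simp [h0]) (by simp [h3]) (by simp [h20])
            (by simp) (by simp [h19]) (by simp) (by simpa using hsh) hbd.2 h hx) ?_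
            (t₂ := 0) (by omega)
          rintro _ v' ⟨rfl, ⟨h1, h2, h4⟩, hf⟩
          refine Within.done ⟨rfl, ⟨h1, h2, ?_⟩, fun i hi => ?_⟩
          · rw [← h4]
            exact if_neg (not_lt.2 h)
          · rw [hf i hi]
            simp (disch := omega) only [Function.update_of_ne]

/-- The registers that hold the parameters of the main data structure. -/
structure MainRegs (w L q h : ℕ) (v : ℕ → ℕ) : Prop where
  h2 : v 2 = w
  h3 : v 3 = 1
  h7 : v 7 = 1
  h8 : v 8 = L
  h9 : v 9 = q
  h10 : v 10 = 2 ^ h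
  h11 : v 11 = 2 ^ q - 1
  h12 : v 12 = 2 ^ L - 1
  h13 : v 13 = 5
  h20 : v 20 = 0

theorem MainRegs.congr {L q h : ℕ} {v v' : ℕ → ℕ} (H : MainRegs w L q h v)
    (hf : ∀ i, i = 2 ∨ i = 3 ∨ (7 ≤ i ∧ i ≤ 13) ∨ i = 20 → v' i = v i) : MainRegs w L q h v' where
  h2 := by rw [hf _ (by omega), H.h2]
  h3 := by rw [hf _ (by omega), H.h3]
  h7 := by rw [hf _ (by omega), H.h7]
  h8 := by rw [hf _ (by omega), H.h8]
  h9 := by rw [hf _ (by omega), H.h9]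
  h10 := by rw [hf _ (by omega), H.h10]
  h11 := by rw [hf _ (by omega), H.h11]
  h12 := by rw [hf _ (by omega), H.h12]
  h13 := by rw [hf _ (by omega), H.h13]
  h20 := by rw [hf _ (by omega), H.h20]

/-- The slots with numbers `5`, …, `5 * 2 ^ h + 4`, of `L` bits each, `2 ^ q` to the word, hold the
numbers `item`. -/
def SlotsHold (w : ℕ) (mem : ℕ → ℕ) (L q h : ℕ) (item : ℕ → ℕ) : Prop :=
  ∀ j, 5 ≤ j → j < 5 * (2 ^ h + 1) →
    j < 2 ^ w ∧ j % 2 ^ q * L < 2 ^ w ∧ mem (j / 2 ^ q) >>> (j % 2 ^ q * L) % 2 ^ L = item j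

/-- The candidates are the `2 ^ k` blocks from `pos` on. The last block has no successor to compare
with, so the upper bound on `x` is required only when the interval ends before it. A power of two of
blocks lets every round halve the interval exactly. -/
theorem within_search (hP : CodeAt P 50 searchCode) {L q h x : ℕ} {item : ℕ → ℕ} (hs : SlotsHold w mem L q h item) (k : ℕ) :
    ∀ (v : ℕ → ℕ) (pos : ℕ), MainRegs w L q h v → v 0 = x → v 14 = 2 ^ k → v 15 = pos → 1 ≤ pos →
    pos + 2 ^ k ≤ 2 ^ h + 1 → item (5 * pos) ≤ x →
    (pos + 2 ^ k < 2 ^ h + 1 → x < item (5 * (pos + 2 ^ k))) →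
    Within w P mem (13 * k + 1) 50 v fun pc v' => pc = 63 ∧
      (1 ≤ v' 15 ∧ v' 15 ≤ 2 ^ h ∧ item (5 * v' 15) ≤ x ∧
        (v' 15 < 2 ^ h → x < item (5 * (v' 15 + 1)))) ∧
      ∀ i, i ≤ 13 ∨ (19 ≤ i ∧ i ≤ 27) → v' i = v i := by
  induction k with
  | zero =>
    intro v pos H h0 h14 h15 hpos hle hx hx'
    refine Within.jeq (hP 0 _ rfl) (fun _ => Within.done ⟨rfl, ?_, fun i _ => rfl⟩) (fun h => ?_)
    · rw [h15]
      rw [pow_zero] at hle hx'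
      exact ⟨hpos, by omega, hx, fun h => hx' (by omega)⟩
    · rw [h14, H.h3] at h
      exact absurd rfl h
  | succ k ih =>
    intro v pos H h0 h14 h15 hpos hle hx hx'
    have hk := Nat.two_pow_pos k
    have hk2 : 2 ^ (k + 1) = 2 * 2 ^ k := by ring
    obtain ⟨hb1, hb2, hb3⟩ := hs (5 * (pos + 2 ^ k)) (by omega) (by omega)
    rw [show 13 * (k + 1) + 1 = 13 * k + 10 + 1 + 1 + 1 + 1 by ring]
    refine Within.jeq (hP 0 _ rfl) (fun h => ?_) (fun _ => ?_)
    · rw [h14, H.h3] at h; omega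
    refine Within.shr (2 ^ k) (hP 1 _ rfl) ?_ ?_
    · rw [h14, H.h3, Nat.shiftRight_one]; omega
    refine Within.add (pos + 2 ^ k) (hP 2 _ rfl) (by simp [h15]) (by omega) ?_
    refine Within.mul (5 * (pos + 2 ^ k)) (hP 3 _ rfl) (by simp [H.h13, mul_comm]) hb1 ?_
    refine Within.bind (within_readSlot (k := 54) hP.append_right.append_left
      (j := 5 * (pos + 2 ^ k)) (q := q) (L := L) (item (5 * (pos + 2 ^ k))) (by decide) (by simp) (by simp [H.h9]) (by simp [H.h11]) (by simp [H.h8]) (by simp [H.h12])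
      hb2 hb3) ?_ (t₂ := 13 * k + 4) (by omega)
    rintro _ v' ⟨rfl, h18', hf⟩
    have hf' : ∀ i, i ≠ 28 → i ≠ 18 → i ≠ 14 → i ≠ 16 → i ≠ 17 → v' i = v i := by
      intro i a b c d e
      rw [hf i a b]
      simp [c, d, e]
    have h14' : v' 14 = 2 ^ k := by rw [hf 14 (by decide) (by decide)]; simp
    have h16' : v' 16 = pos + 2 ^ k := by rw [hf 16 (by decide) (by decide)]; simp
    have H' : MainRegs w L q h v' := H.congr fun i hi => hf' i (by omega) (by omega) (by omega)
      (by omega) (by omega)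
    have h0' : v' 0 = x := by rw [hf' 0 (by decide) (by decide) (by decide) (by decide) (by decide), h0]
    refine Within.jlt (hP 10 _ rfl) (fun h => ?_) (fun h => ?_)
    · rw [h0', h18'] at h
      refine Within.bind (ih v' pos H' h0' h14' ?_ hpos (by omega) hx fun _ => h) ?_ (t₂ := 0)
        (by omega)
      · rw [hf' 15 (by decide) (by decide) (by decide) (by decide) (by decide), h15]
      · rintro _ v'' ⟨rfl, h1, hf''⟩
        refine Within.done ⟨rfl, h1, fun i hi => ?_⟩
        rw [hf'' i hi, hf' i (by omega) (by omega) (by omega) (by omega) (by omega)]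
    · rw [h0', h18'] at h
      refine Within.copy (pos + 2 ^ k) (hP 11 _ rfl) h16' H'.h20 (Within.jump (hP 12 _ rfl) ?_)
      refine Within.bind (ih _ (pos + 2 ^ k) (H'.congr fun i hi => Function.update_of_ne (by omega) _ _)
        (by simp [h0']) (by simp [h14']) (by simp) (by omega) (by omega) h fun hlt => ?_) ?_ (t₂ := 0)
        (by omega)
      · rw [add_assoc, ← two_mul, ← hk2]
        exact hx' (by omega)
      · rintro _ v'' ⟨rfl, h1, hf''⟩
        refine Within.done ⟨rfl, h1, fun i hi => ?_⟩
        rw [hf'' i hi, Function.update_of_ne (by omega),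
          hf' i (by omega) (by omega) (by omega) (by omega) (by omega)]

end Program

end WordRAM

namespace WordRAM

section Program

variable {w : ℕ} {mem : ℕ → ℕ} {P : Program}

theorem within_nextSlot {k d : ℕ} (hP : CodeAt P k ([.op .add 17 17 3] ++ readSlot d))
    {L q h : ℕ} {item : ℕ → ℕ} (hs : SlotsHold w mem L q h item)
    (hd : 18 ≤ d ∧ d ≠ 20 ∧ d ≠ 28) {v : ℕ → ℕ} {j : ℕ} (H : MainRegs w L q h v) (h17 : v 17 = j)
    (hj : 5 ≤ j + 1) (hj' : j + 1 < 5 * (2 ^ h + 1)) :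
    Within w P mem 7 k v fun pc v' => pc = k + 7 ∧ v' d = item (j + 1) ∧ v' 17 = j + 1 ∧
      ∀ i, i ≠ 17 → i ≠ 28 → i ≠ d → v' i = v i := by
  obtain ⟨hb1, hb2, hb3⟩ := hs (j + 1) hj hj'
  refine Within.add (j + 1) (hP 0 _ rfl) (by rw [h17, H.h3]) hb1 ?_
  refine Within.bind (within_readSlot (k := k + 1) hP.append_right (item (j + 1))
    (j := j + 1) (q := q) (L := L) (by omega) (by simp) (by simp [H.h9]) (by simp [H.h11])
    (by simp [H.h8]) (by simp [H.h12]) hb2 hb3) ?_ (t₂ := 0) (by omega)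
  rintro _ v' ⟨rfl, h1, hf⟩
  refine Within.done ⟨by omega, h1, ?_, fun i a b c => ?_⟩
  · rw [hf 17 (by decide) (by omega)]; simp
  · rw [hf i b c, Function.update_of_ne a]

theorem within_load (hP : CodeAt P 63 loadCode) {L q h : ℕ} {item : ℕ → ℕ}
    (hs : SlotsHold w mem L q h item) {v : ℕ → ℕ} {pos : ℕ} (H : MainRegs w L q h v)
    (h15 : v 15 = pos) (hpos : 1 ≤ pos) (hpos' : pos ≤ 2 ^ h) :
    Within w P mem 35 63 v fun pc v' => pc = 98 ∧ (v' 18 = item (5 * pos) ∧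
      v' 19 = item (5 * pos + 1) ∧ v' 21 = item (5 * pos + 2) ∧ v' 22 = item (5 * pos + 3) ∧
      v' 23 = item (5 * pos + 4)) ∧ ∀ i, i ≤ 13 ∨ i = 20 ∨ (24 ≤ i ∧ i ≤ 27) → v' i = v i := by
  obtain ⟨hb1, hb2, hb3⟩ := hs (5 * pos) (by omega) (by omega)
  refine Within.mul (5 * pos) (hP 0 _ rfl) (by rw [h15, H.h13, mul_comm]) hb1 ?_
  have hP1 : CodeAt P 64 _ := hP.append_right
  have hP2 : CodeAt P 70 _ := hP1.append_right
  -- Regrouping joins each increment of the slot number to the read after it, the shape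
  -- `within_nextSlot` expects.
  rw [← List.append_assoc] at hP2
  have hP3 : CodeAt P 77 _ := hP2.append_right
  rw [← List.append_assoc] at hP3
  have hP4 : CodeAt P 84 _ := hP3.append_right
  rw [← List.append_assoc] at hP4
  have hP5 : CodeAt P 91 _ := hP4.append_right
  refine Within.bind (within_readSlot hP1.append_left (item (5 * pos))
    (j := 5 * pos) (q := q) (L := L) (by decide) (by simp) (by simp [H.h9]) (by simp [H.h11])
    (by simp [H.h8]) (by simp [H.h12]) hb2 hb3) ?_ (t₂ := 28) (by omega)
  rintro _ v1 ⟨rfl, hv1, hf1⟩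
  have H1 : MainRegs w L q h v1 := H.congr fun i hi => by
    rw [hf1 i (by omega) (by omega), Function.update_of_ne (by omega)]
  refine Within.bind (within_nextSlot hP2.append_left hs (by decide) H1
    (j := 5 * pos) (by rw [hf1 17 (by decide) (by decide)]; simp) (by omega) (by omega)) ?_
    (t₂ := 21) (by omega)
  rintro _ v2 ⟨rfl, hv2, h17, hf2⟩
  have H2 : MainRegs w L q h v2 := H1.congr fun i hi => hf2 i (by omega) (by omega) (by omega)
  refine Within.bind (within_nextSlot hP3.append_left hs (by decide) H2 h17 (by omega) (by omega)) ?_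
    (t₂ := 14) (by omega)
  rintro _ v3 ⟨rfl, hv3, h17, hf3⟩
  have H3 : MainRegs w L q h v3 := H2.congr fun i hi => hf3 i (by omega) (by omega) (by omega)
  refine Within.bind (within_nextSlot hP4.append_left hs (by decide) H3 h17 (by omega) (by omega)) ?_
    (t₂ := 7) (by omega)
  rintro _ v4 ⟨rfl, hv4, h17, hf4⟩
  have H4 : MainRegs w L q h v4 := H3.congr fun i hi => hf4 i (by omega) (by omega) (by omega)
  refine Within.bind (within_nextSlot hP5 hs (by decide) H4 h17 (by omega) (by omega)) ?_
    (t₂ := 0) (by omega)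
  rintro _ v5 ⟨rfl, hv5, -, hf5⟩
  refine Within.done ⟨rfl, ⟨?_, ?_, ?_, ?_, hv5⟩, fun i hi => ?_⟩
  · rw [hf5 _ (by decide) (by decide) (by decide), hf4 _ (by decide) (by decide) (by decide),
      hf3 _ (by decide) (by decide) (by decide), hf2 _ (by decide) (by decide) (by decide), hv1]
  · rw [hf5 _ (by decide) (by decide) (by decide), hf4 _ (by decide) (by decide) (by decide),
      hf3 _ (by decide) (by decide) (by decide), hv2]
  · rw [hf5 _ (by decide) (by decide) (by decide), hf4 _ (by decide) (by decide) (by decide), hv3]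
  · rw [hf5 _ (by decide) (by decide) (by decide), hv4]
  · rw [hf5 _ (by omega) (by omega) (by omega), hf4 _ (by omega) (by omega) (by omega),
      hf3 _ (by omega) (by omega) (by omega), hf2 _ (by omega) (by omega) (by omega),
      hf1 _ (by omega) (by omega), Function.update_of_ne (by omega)]

theorem within_division (hP : CodeAt P 116 divisionCode) {x L : ℕ} {v : ℕ → ℕ} (hx : x < 2 ^ w)
    (hxL : x < 2 ^ L) (h0 : v 0 = x) (h3 : v 3 = 1) (h20 : v 20 = 0) (h18 : v 18 ≤ x)
    (h19 : 1 ≤ v 19) :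
    Within w P mem (9 * L + 9) 116 v fun pc v' => pc = 145 ∧
      v' 0 = x - (x - v 18) % v 19 ∧ ∀ i, i ≠ 0 → i ≠ 18 → i ≠ 21 → i ≠ 24 → v' i = v i := by
  rw [show 9 * L + 9 = 9 * L + 7 + 1 + 1 by ring]
  refine Within.sub (x - v 18) (hP 0 _ rfl) (by omega) (by omega) ?_
  refine Within.copy (v 19) (hP 1 _ rfl) (by simp) (by simp [h20]) ?_
  refine Within.bind (within_double hP (r := x - v 18) (s := v 19) (by omega) L _ 0 (by simp [h3])
    (by simp) (by simp) ?_) ?_ (t₂ := 5 * L + 5) (by omega)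
  · rw [pow_zero, mul_one]
    calc x - v 18 ≤ x := Nat.sub_le _ _
      _ < 2 ^ L := hxL
      _ ≤ _ := Nat.le_mul_of_pos_left _ h19
  rintro _ v1 ⟨rfl, ⟨j, hj, h21, hlt⟩, hf1⟩
  refine Within.bind (within_reduce hP h19 j v1 (x - v 18) ?_ ?_ ?_ h21 hlt (by omega)) ?_
    (t₂ := 2) (by omega)
  · rw [hf1 3 (by decide) (by decide)]; simp [h3]
  · rw [hf1 18 (by decide) (by decide)]; simp
  · rw [hf1 19 (by decide) (by decide)]; simp
  rintro _ v2 ⟨rfl, h18', hf2⟩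
  have h0' : v2 0 = x := by
    rw [hf2 0 (by decide) (by decide), hf1 0 (by decide) (by decide)]; simp [h0]
  have hmod := Nat.mod_le (x - v 18) (v 19)
  refine Within.sub (x - (x - v 18) % v 19) (hP 11 _ rfl) (by omega) (by omega) ?_
  refine Within.jump (hP 12 _ rfl) (Within.done ⟨rfl, by simp, fun i a b c d => ?_⟩)
  rw [Function.update_of_ne a, hf2 i b c, hf1 i c d, Function.update_of_ne c,
    Function.update_of_ne b]

/-- The numbers `item` describe the operations `ops`, in blocks of `L` operations: the state before
the block, and the two bit planes of its operations. -/
def BlocksHold (L h : ℕ) (item : ℕ → ℕ) (ops : List (Bool × Bool)) : Prop :=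
  ops.length = 2 ^ h * L ∧ ∀ j < 2 ^ h,
    ((ops.take (j * L)).foldl opStep (0, 0, 0) =
      (item (5 * (j + 1)), item (5 * (j + 1) + 1), item (5 * (j + 1) + 2))) ∧
    ∀ i < L, (item (5 * (j + 1) + 3)).testBit i = (ops.getD (j * L + i) (false, false)).1 ∧
      (item (5 * (j + 1) + 4)).testBit i = (ops.getD (j * L + i) (false, false)).2

/-- The stored state allows `findStart` to begin at the block found, as the earlier operations do
not pass `x`; the operations after the block are irrelevant, as `x` is passed inside it. -/
theorem within_main (hE : CodeAt P 46 entryCode) (hS : CodeAt P 50 searchCode)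
    (hL : CodeAt P 63 loadCode) (hO : CodeAt P 98 opsCode) (hD : CodeAt P 116 divisionCode)
    {L q h n x : ℕ} {item : ℕ → ℕ} {ops : List (Bool × Bool)} (hs : SlotsHold w mem L q h item)
    (hb : BlocksHold L h item ops) (hbd : StatesBounded n (0, 0, 0) ops) (hn : n < 2 ^ w)
    (hnL : n < 2 ^ L) (hfin : (ops.foldl opStep (0, 0, 0)).1 = n) (hx : x < n) {v : ℕ → ℕ}
    (H : MainRegs w L q h v) (h0 : v 0 = x + 1) :
    Within w P mem (13 * h + 21 * L + 49) 46 v fun pc v' => pc = 145 ∧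
      v' 0 = findStart x (0, 0, 0) ops ∧
      ∀ i, (1 ≤ i ∧ i ≤ 13) ∨ i = 20 ∨ i = 26 ∨ i = 27 → v' i = v i := by
  obtain ⟨hlen, hb⟩ := hb
  have hpos := Nat.two_pow_pos h
  rw [show 13 * h + 21 * L + 49 = 13 * h + 21 * L + 45 + 1 + 1 + 1 + 1 by ring]
  refine Within.sub x (hE 0 _ rfl) (by rw [h0, H.h3]) (by omega) ?_
  refine Within.jeq (hE 1 _ rfl) (fun h => ?_) (fun _ => ?_)
  · simp [H.h7, H.h20] at h
  refine Within.copy (2 ^ h) (hE 2 _ rfl) (by simp [H.h10]) (by simp [H.h20]) ?_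
  refine Within.copy 1 (hE 3 _ rfl) (by simp [H.h3]) (by simp [H.h20]) ?_
  have e0 := (hb 0 hpos).1
  rw [zero_mul, List.take_zero, List.foldl_nil, zero_add] at e0
  have e01 : item 5 = 0 := (congrArg Prod.fst e0).symm
  refine Within.bind (within_search hS hs (x := x) h _ 1 (H.congr fun i hi => ?_) (by simp) (by simp)
    (by simp) le_rfl (by omega) (by rw [mul_one, e01]; exact Nat.zero_le _) (fun hlt => ?_)) ?_
    (t₂ := 21 * L + 44) (by omega)
  · rw [Function.update_of_ne (by omega), Function.update_of_ne (by omega),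
      Function.update_of_ne (by omega)]
  · omega
  rintro _ v1 ⟨rfl, ⟨hp1, hp2, hp3, hp4⟩, hf1⟩
  have hf1' : ∀ i, (1 ≤ i ∧ i ≤ 13) ∨ i = 20 ∨ i = 26 ∨ i = 27 → v1 i = v i := by
    intro i hi
    rw [hf1 i (by omega), Function.update_of_ne (by omega), Function.update_of_ne (by omega),
      Function.update_of_ne (by omega)]
  have h01 : v1 0 = x := by rw [hf1 0 (by omega)]; simp
  have H1 : MainRegs w L q h v1 := H.congr fun i hi => hf1' i (by omega)
  refine Within.bind (within_load hL hs H1 rfl hp1 hp2) ?_ (t₂ := 21 * L + 9) (by omega)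
  rintro _ v2 ⟨rfl, ⟨h18, h19, h21, h22, h23⟩, hf2⟩
  obtain ⟨j, hj⟩ : ∃ j, v1 15 = j + 1 := ⟨v1 15 - 1, by omega⟩
  rw [hj] at hp2 hp3 hp4 h18 h19 h21 h22 h23
  obtain ⟨hst, hbits⟩ := hb j (by omega)
  rw [← h18] at hp3
  rw [← h18, ← h19, ← h21] at hst
  have hjL : (j + 1) * L ≤ 2 ^ h * L := Nat.mul_le_mul_right _ hp2
  rw [add_mul, one_mul] at hjL
  have hsplit : ops = ops.take (j * L) ++ ((ops.drop (j * L)).take L ++ (ops.drop (j * L)).drop L) := by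
    rw [List.take_append_drop, List.take_append_drop]
  -- The position at the end of the block is the stored start of the next block or, for the last
  -- block, the total `n`.
  have hseg : x < (((ops.drop (j * L)).take L).foldl opStep (v2 18, v2 19, v2 21)).1 := by
    rw [← hst, ← List.foldl_append, ← List.take_add]
    rcases hp2.lt_or_eq with hlt | heq
    · have := (hb (j + 1) hlt).1
      rw [add_mul, one_mul] at this
      rw [this]
      exact hp4 hlt
    · rw [List.take_of_length_le, hfin]
      · exact hx
      · rw [hlen, ← heq, add_mul, one_mul]
  have hfind : findStart x (0, 0, 0) ops =
      findStart x (v2 18, v2 19, v2 21) ((ops.drop (j * L)).take L) := by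
    conv_lhs => rw [hsplit]
    rw [findStart_append _ _ _ (by rw [hst]; exact hp3), hst, findStart_append_of_lt _ _ _ hp3 hseg]
  have hbd' : StatesBounded n (v2 18, v2 19, v2 21) ((ops.drop (j * L)).take L) := by
    rw [hsplit, statesBounded_append, statesBounded_append, hst] at hbd
    exact hbd.2.1
  have hf2' : ∀ i, (1 ≤ i ∧ i ≤ 13) ∨ i = 20 ∨ i = 26 ∨ i = 27 → v2 i = v i := by
    intro i hi
    rw [hf2 i (by omega), hf1' i hi]
  have hseglen : ((ops.drop (j * L)).take L).length = L := by
    rw [List.length_take, List.length_drop, hlen]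
    omega
  refine Within.bind (within_ops hO hn ((ops.drop (j * L)).take L) v2 (v2 18) (v2 19) (v2 21)
    (by rw [hf2 0 (by omega), h01]) (by rw [hf2' 3 (by omega), H.h3])
    (by rw [hf2' 20 (by omega), H.h20]) rfl rfl rfl ?_ hbd' hp3 hseg) ?_ (t₂ := 9 * L + 9)
    (by rw [hseglen]; omega)
  · intro i hi
    rw [hseglen] at hi
    have := hbits i hi
    rw [← h22, ← h23, List.getD_eq_getElem _ _ (by omega)] at this
    simpa using this
  rintro _ v3 ⟨rfl, ⟨h18', h19', hres⟩, hf3⟩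
  refine Within.bind (within_division hD (L := L) (x := x) (by omega) (by omega)
    (by rw [hf3 0 (by omega), hf2 0 (by omega), h01])
    (by rw [hf3 3 (by omega), hf2' 3 (by omega), H.h3])
    (by rw [hf3 20 (by omega), hf2' 20 (by omega), H.h20]) h18' h19') ?_ (t₂ := 0) (by omega)
  rintro _ v4 ⟨rfl, h04, hf4⟩
  refine Within.done ⟨rfl, ?_, fun i hi => ?_⟩
  · rw [h04, hfind, hres]
  · rw [hf4 i (by omega) (by omega) (by omega) (by omega), hf3 i (by omega), hf2' i hi]

/-- Register `9` holds the start of the piece of the preceding position and is overwritten at each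
first element. Positions in `D` are shifted by `1` because of the mode bit. -/
theorem within_scan_loop {D : List Bool} (hP : CodeAt P 129 scanCode) (hw : 1 ≤ w) {x : ℕ}
    (hx : x + 2 < w * 2 ^ w) (hxw : x < 2 ^ w) {cs : List ℕ} (hcs : ∀ c ∈ cs, 1 ≤ c)
    (hbits : ∀ i ≤ x, D.getD (1 + i) false = decide (pieceStart cs i = i)) (m : ℕ) :
    ∀ (v : ℕ → ℕ) (i : ℕ), i + m = x → v 0 = x → v 2 = w → v 3 = 1 → v 20 = 0 →
    v 4 = (1 + i) / w → v 5 = (1 + i) % w → v 8 = i → (i = 0 ∨ v 9 = pieceStart cs (i - 1)) →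
    Within w P (memNat w D) (12 * m + 12) 132 v fun pc v' => pc = 145 ∧ v' 0 = pieceStart cs x ∧
      ∀ i, (1 ≤ i ∧ i ≤ 3) ∨ i = 7 ∨ 10 ≤ i → v' i = v i := by
  have hget : CodeAt P 132 (getBit 132) := hP.append_right.append_left
  have hstep : ∀ (t : ℕ) (Q : ℕ → (ℕ → ℕ) → Prop) (v : ℕ → ℕ) (i : ℕ), i ≤ x → v 2 = w → v 3 = 1 →
      v 20 = 0 → v 4 = (1 + i) / w → v 5 = (1 + i) % w → v 8 = i →
      (i = 0 ∨ v 9 = pieceStart cs (i - 1)) →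
      (∀ v', v' 4 = (1 + (i + 1)) / w → v' 5 = (1 + (i + 1)) % w → v' 9 = pieceStart cs i →
        (∀ i, i ≠ 4 → i ≠ 5 → i ≠ 6 → i ≠ 9 → v' i = v i) → Within w P (memNat w D) t 141 v' Q) →
      Within w P (memNat w D) (t + 9) 132 v Q := by
    intro t Q v i hi h2 h3 h20 h4 h5 h8 h9 h
    refine Within.bind (within_getBit hget hw h2 h3 h4 h5 (by omega)) ?_ (t₂ := t + 1 + 1) (by omega)
    rintro _ v' ⟨rfl, h6', h4', h5', hf⟩
    rw [hbits i hi] at h6'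
    have h20' : v' 20 = 0 := by rw [hf 20 (by decide) (by decide) (by decide), h20]
    have h9' : v' 9 = v 9 := hf 9 (by decide) (by decide) (by decide)
    refine Within.jeq (hP 10 _ rfl) (fun he => ?_) (fun he => ?_)
    · refine (h v' h4' h5' ?_ fun i a b c _ => hf i a b c).mono (by omega)
      rw [h6', h20'] at he
      have hne : pieceStart cs i ≠ i := by
        intro hc
        simp [hc] at he
      rw [h9']
      rcases h9 with rfl | h9
      · exact absurd (pieceStart_zero cs hcs) hne
      · rw [h9]
        obtain ⟨j, rfl⟩ : ∃ j, i = j + 1 := by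
          rcases i with _ | j
          · exact absurd (pieceStart_zero cs hcs) hne
          · exact ⟨j, rfl⟩
        exact ((pieceStart_succ cs hcs j).resolve_left hne).symm
    · rw [h6', h20'] at he
      have heq : pieceStart cs i = i := by
        by_contra hc
        simp [hc] at he
      refine Within.copy i (hP 11 _ rfl) (by rw [hf 8 (by decide) (by decide) (by decide), h8]) h20' ?_
      refine h _ (by simp [h4', add_assoc]) (by simp [h5', add_assoc]) (by simp [heq])
        fun i a b c d => ?_
      rw [Function.update_of_ne d, hf i a b c]
  induction m with
  | zero =>
    intro v i him h0 h2 h3 h20 h4 h5 h8 h9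
    refine hstep 3 _ v i (by omega) h2 h3 h20 h4 h5 h8 h9 fun v' h4' h5' h9' hf => ?_
    refine Within.jeq (hP 12 _ rfl) (fun _ => ?_) (fun he => ?_)
    · refine Within.copy (pieceStart cs x) (hP 15 _ rfl) ?_ ?_ (Within.done ⟨rfl, by simp, ?_⟩)
      · rw [h9', ← him, add_zero]
      · rw [hf 20 (by decide) (by decide) (by decide) (by decide), h20]
      · intro i hi
        rw [Function.update_of_ne (by omega), hf i (by omega) (by omega) (by omega) (by omega)]
    · rw [hf 8 (by decide) (by decide) (by decide) (by decide),
        hf 0 (by decide) (by decide) (by decide) (by decide), h8, h0] at he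
      omega
  | succ m ih =>
    intro v i him h0 h2 h3 h20 h4 h5 h8 h9
    rw [show 12 * (m + 1) + 12 = 12 * m + 12 + 1 + 1 + 1 + 9 by ring]
    refine hstep _ _ v i (by omega) h2 h3 h20 h4 h5 h8 h9 fun v' h4' h5' h9' hf => ?_
    have hf' : ∀ i, i ≠ 4 → i ≠ 5 → i ≠ 6 → i ≠ 9 → i ≠ 8 →
        Function.update v' 8 (i + 1) i = v i := by
      intro i a b c d e
      rw [Function.update_of_ne e, hf i a b c d]
    refine Within.jeq (hP 12 _ rfl) (fun he => ?_) (fun _ => ?_)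
    · rw [hf 8 (by decide) (by decide) (by decide) (by decide),
        hf 0 (by decide) (by decide) (by decide) (by decide), h8, h0] at he
      omega
    refine Within.add (i + 1) (hP 13 _ rfl) ?_ (by omega) (Within.jump (hP 14 _ rfl) ?_)
    · rw [hf 8 (by decide) (by decide) (by decide) (by decide),
        hf 3 (by decide) (by decide) (by decide) (by decide), h8, h3]
    refine Within.bind (ih _ (i + 1) (by omega) ?_ ?_ ?_ ?_ ?_ ?_ (by simp) (Or.inr ?_)) ?_ (t₂ := 0)
      (by omega)
    · rw [Function.update_of_ne (by decide), hf _ (by decide) (by decide) (by decide) (by decide), h0]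
    · rw [Function.update_of_ne (by decide), hf _ (by decide) (by decide) (by decide) (by decide), h2]
    · rw [Function.update_of_ne (by decide), hf _ (by decide) (by decide) (by decide) (by decide), h3]
    · rw [Function.update_of_ne (by decide), hf _ (by decide) (by decide) (by decide) (by decide), h20]
    · rw [Function.update_of_ne (by decide), h4']
    · rw [Function.update_of_ne (by decide), h5']
    · rw [Function.update_of_ne (by decide), h9', Nat.add_sub_cancel]
    rintro _ v'' ⟨rfl, h1, hf''⟩
    refine Within.done ⟨rfl, h1, fun i hi => ?_⟩
    rw [hf'' i hi, Function.update_of_ne (by omega),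
      hf i (by omega) (by omega) (by omega) (by omega)]

theorem within_scan {D : List Bool} (hE : CodeAt P 46 entryCode) (hP : CodeAt P 129 scanCode)
    (hw : 2 ≤ w) {x : ℕ} (hx : x + 2 < w * 2 ^ w) (hxw : x + 1 < 2 ^ w) {cs : List ℕ}
    (hcs : ∀ c ∈ cs, 1 ≤ c)
    (hbits : ∀ i ≤ x, D.getD (1 + i) false = decide (pieceStart cs i = i)) {v : ℕ → ℕ}
    (h0 : v 0 = x + 1) (h2 : v 2 = w) (h3 : v 3 = 1) (h7 : v 7 = 0) (h20 : v 20 = 0) :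
    Within w P (memNat w D) (12 * x + 17) 46 v fun pc v' => pc = 145 ∧ v' 0 = pieceStart cs x ∧
      ∀ i, (1 ≤ i ∧ i ≤ 3) ∨ i = 7 ∨ 10 ≤ i → v' i = v i := by
  have h4w : 2 ^ 2 ≤ 2 ^ w := Nat.pow_le_pow_right (by decide) hw
  rw [show 12 * x + 17 = 12 * x + 12 + 1 + 1 + 1 + 1 + 1 by ring]
  refine Within.sub x (hE 0 _ rfl) (by rw [h0, h3]) (by omega) ?_
  refine Within.jeq (hE 1 _ rfl) (fun _ => ?_) (fun h => ?_)
  swap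
  · simp [h7, h20] at h
  refine Within.const 0 (hP 0 _ rfl) (Nat.zero_mod _) ?_
  refine Within.const 1 (hP 1 _ rfl) (Nat.mod_eq_of_lt (by omega)) ?_
  refine Within.const 0 (hP 2 _ rfl) (Nat.zero_mod _) ?_
  refine Within.bind (within_scan_loop hP (by omega) hx (by omega) hcs hbits x _ 0 (by omega)
    (by simp) (by simp [h2]) (by simp [h3]) (by simp [h20]) ?_ ?_ (by simp) (Or.inl rfl)) ?_
    (t₂ := 0) (by omega)
  · simp [Nat.div_eq_of_lt (show 1 < w by omega)]
  · simp [Nat.mod_eq_of_lt (show 1 < w by omega)]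
  rintro _ v' ⟨rfl, h1, hf⟩
  refine Within.done ⟨rfl, h1, fun i hi => ?_⟩
  rw [hf i hi]
  simp (disch := omega) only [Function.update_of_ne]

/-- The same code runs for both elements: register `26` tells the second run from the first, and
register `27` keeps the first result. The invariant `Inv` stands for the parameters of either mode.
-/
theorem within_answer (hP : CodeAt P 145 answerCode) (hw : 1 ≤ w) {Inv : (ℕ → ℕ) → Prop}
    {rep : ℕ → ℕ} {n T : ℕ}
    (hInv : ∀ v v', Inv v → (∀ i, i = 2 ∨ i = 3 ∨ (7 ≤ i ∧ i ≤ 13) ∨ i = 20 → v' i = v i) → Inv v')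
    (hInv' : ∀ v, Inv v → v 3 = 1 ∧ v 20 = 0)
    (hrep : ∀ v x, Inv v → v 0 = x + 1 → x < n → Within w P mem T 46 v fun pc v' => pc = 145 ∧
      v' 0 = rep x ∧ Inv v' ∧ ∀ i, i = 1 ∨ i = 26 ∨ i = 27 → v' i = v i)
    {v : ℕ → ℕ} {x y : ℕ} (hv : Inv v) (h0 : v 0 = x + 1) (h1 : v 1 = y + 1) (h26 : v 26 = 0)
    (hx : x < n) (hy : y < n) :
    Within w P mem (2 * T + 9) 46 v fun pc v' => pc = 154 ∧
      v' 0 = if rep x = rep y then 1 else 0 := by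
  refine Within.bind (hrep v x hv h0 hx) ?_ (t₂ := T + 4 + 1 + 1 + 1 + 1 + 1) (by omega)
  rintro _ v1 ⟨rfl, hr1, hv1, hf1⟩
  obtain ⟨h3, h20⟩ := hInv' v1 hv1
  refine Within.jeq (hP 0 _ rfl) (fun h => ?_) (fun _ => ?_)
  · rw [hf1 26 (by omega), h26, h3] at h
    omega
  refine Within.copy 1 (hP 1 _ rfl) h3 h20 ?_
  refine Within.copy (rep x) (hP 2 _ rfl) (by simp [hr1]) (by simp [h20]) ?_
  refine Within.copy (y + 1) (hP 3 _ rfl) (by simp [hf1 1 (by omega), h1]) (by simp [h20]) ?_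
  refine Within.jump (hP 4 _ rfl) ?_
  refine Within.bind (hrep _ y (hInv v1 _ hv1 fun i hi => ?_) (by simp) hy) ?_ (t₂ := 4) (by omega)
  · simp (disch := omega) only [Function.update_of_ne]
  rintro _ v2 ⟨rfl, hr2, hv2, hf2⟩
  obtain ⟨h3', -⟩ := hInv' v2 hv2
  have h26' : v2 26 = 1 := by rw [hf2 26 (by omega)]; simp
  have h27' : v2 27 = rep x := by rw [hf2 27 (by omega)]; simp
  have h1w : 1 < 2 ^ w := Nat.one_lt_two_pow (by omega)
  refine Within.jeq (hP 0 _ rfl) (fun _ => ?_) (fun h => ?_)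
  swap
  · rw [h26', h3'] at h
    exact absurd rfl h
  refine Within.jeq (hP 5 _ rfl) (fun h => ?_) (fun h => ?_)
  · refine Within.const 1 (hP 8 _ rfl) (Nat.mod_eq_of_lt h1w) (Within.done ⟨rfl, ?_⟩)
    rw [hr2, h27'] at h
    simp [h]
  · refine Within.const 0 (hP 6 _ rfl) (Nat.zero_mod _) ?_
    refine Within.jump (hP 7 _ rfl) (Within.done ⟨rfl, ?_⟩)
    rw [hr2, h27'] at h
    rw [if_neg (Ne.symm h)]
    simp

end Program

end WordRAM

/-! ### Halting, the header and the layout of the memory -/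

namespace WordRAM

section Program

variable {w : ℕ} {P : Program}

theorem answersWithin_of_within {D : List Bool} {x y t : ℕ} {a : BitVec w}
    (h : Within w P (memNat w D) t 0 (initial w x y).toNats.2 fun pc v => P.length ≤ pc ∧
      v 0 = a.toNat) : AnswersWithin P w D x y a t := by
  obtain ⟨t', ht, h1, h2⟩ := h
  have e : ((0, (initial w x y).toNats.2) : ℕ × (ℕ → ℕ)) = (initial w x y).toNats := rfl
  rw [e, ← toNats_iterate] at h1 h2
  exact ⟨t', ht, h1, BitVec.toNat_inj.1 h2⟩

theorem step_eq_self_of_halted {mem : BitVec w → BitVec w} {s : Config w} (h : P.length ≤ s.pc) :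
    step P mem s = s := by
  rw [step, List.getElem?_eq_none h]

/-- A halted configuration is a fixed point of the step function, so any two halting times show the
same register contents. Thus the machine's answer is a genuine decision rule. -/
theorem answersWithin_unique {D : List Bool} {x y t t' : ℕ} {a b : BitVec w}
    (h : AnswersWithin P w D x y a t) (h' : AnswersWithin P w D x y b t') : a = b := by
  obtain ⟨i, -, hi, rfl⟩ := h
  obtain ⟨j, -, hj, rfl⟩ := h'
  have key : ∀ i k, P.length ≤ ((step P (pack w D))^[i] (initial w x y)).pc →
      (step P (pack w D))^[k + i] (initial w x y) = (step P (pack w D))^[i] (initial w x y) := by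
    intro i k hi
    rw [Function.iterate_add_apply]
    exact Function.iterate_fixed (step_eq_self_of_halted hi) k
  rcases le_total i j with h | h
  · rw [← key i (j - i) hi, Nat.sub_add_cancel h]
  · rw [← key j (i - j) hj, Nat.sub_add_cancel h]

/-- The header of a data structure in main mode: the mode bit, and `L`, `q`, `h` in unary. -/
def headerBit (L q h pos : ℕ) : Bool :=
  decide (pos ≠ 1 + L ∧ pos ≠ 1 + L + 1 + q ∧ pos ≠ 1 + L + 1 + q + 1 + h)

theorem within_header_main {D : List Bool} (hP : CodeAt P 0 headerCode) {L q h : ℕ}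
    (hw : 3 ≤ w) (hL : L ≤ w) (hq : q ≤ w) (hh : h < w) (hpos : 5 + L + q + h < w * 2 ^ w)
    (hD : ∀ pos < 1 + L + 1 + q + 1 + h + 1, D.getD pos false = headerBit L q h pos) {v : ℕ → ℕ}
    (h2 : v 2 = w) (hv : ∀ i, 3 ≤ i → v i = 0) :
    Within w P (memNat w D) (10 * (L + q + h) + 46) 0 v fun pc v' => pc = 46 ∧
      MainRegs w L q h v' ∧ v' 0 = v 0 ∧ v' 1 = v 1 ∧ v' 26 = 0 := by
  have h8w : 2 ^ 3 ≤ 2 ^ w := Nat.pow_le_pow_right (by decide) hw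
  have hww : w < 2 ^ w := Nat.lt_two_pow_self
  have hP1 : CodeAt P 1 _ := hP.append_right
  have hP8 : CodeAt P 8 _ := hP1.append_right
  have hP10 : CodeAt P 10 _ := hP8.append_right
  have hP20 : CodeAt P 20 _ := hP10.append_right
  have hP30 : CodeAt P 30 _ := hP20.append_right
  have hP40 : CodeAt P 40 _ := hP30.append_right
  rw [show 10 * (L + q + h) + 46 = 10 * (L + q + h) + 45 + 1 by ring]
  refine Within.const 1 (hP 0 _ rfl) (Nat.mod_eq_of_lt (by omega)) ?_
  refine Within.bind (within_getBit hP1.append_left (pos := 0) (by omega) (by simp [h2])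
    (by simp) (by simp [hv]) (by simp [hv]) (by omega)) ?_ (t₂ := 10 * (L + q + h) + 36 + 1 + 1)
    (by omega)
  rintro _ v1 ⟨rfl, h6, h4, h5, hf⟩
  rw [hD 0 (by omega), headerBit, decide_eq_true (by omega)] at h6
  refine Within.copy 1 (hP8 0 _ rfl) h6 (by rw [hf 20 (by decide) (by decide) (by decide)]; simp [hv]) ?_
  have hf1 : ∀ i, i ≠ 3 → i ≠ 4 → i ≠ 5 → i ≠ 6 → i ≠ 7 → Function.update v1 7 1 i = v i := by
    intro i a b c d e
    rw [Function.update_of_ne e, hf i b c d, Function.update_of_ne a]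
  have h31 : Function.update v1 7 1 3 = 1 := by
    rw [Function.update_of_ne (by decide), hf 3 (by decide) (by decide) (by decide)]; simp
  have h71 : Function.update v1 7 1 7 = 1 := by simp
  -- The facts about registers `4` and `5` are moved to the updated register contents, which can
  -- then be generalized.
  rw [← Function.update_of_ne (f := v1) (a := 4) (a' := 7) (by decide) 1] at h4
  rw [← Function.update_of_ne (f := v1) (a := 5) (a' := 7) (by decide) 1] at h5
  generalize Function.update v1 7 1 = v2 at *
  have h20 : v2 20 = 0 := by
    rw [hf1 20 (by decide) (by decide) (by decide) (by decide) (by decide), hv 20 (by decide)]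
  refine Within.jeq (hP8 1 _ rfl) (fun he => ?_) (fun _ => ?_)
  · rw [h71, h20] at he
    exact absurd he (by decide)
  have h22 : v2 2 = w := by
    rw [hf1 2 (by decide) (by decide) (by decide) (by decide) (by decide), h2]
  have hz : ∀ i, 8 ≤ i → v2 i = 0 := fun i hi => by
    rw [hf1 i (by omega) (by omega) (by omega) (by omega) (by omega), hv i (by omega)]
  refine Within.bind (within_readUnary hP10.append_left (by omega) (by decide) L v2 1 h22 h31 h20
    h4 h5 (by omega) (by rw [hz 8 (by decide)]; omega)
    (fun i hi => by rw [hD _ (by omega), headerBit]; exact decide_eq_true (by omega))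
    (by rw [hD _ (by omega), headerBit]; exact decide_eq_false (by omega))) ?_
    (t₂ := 10 * (q + h) + 26) (by omega)
  rintro _ v3 ⟨rfl, h83, h43, h53, hf3⟩
  refine Within.bind (within_readUnary hP20.append_left (by omega) (by decide) q v3 (1 + L + 1)
    (by rw [hf3 2 (by decide) (by decide) (by decide) (by decide), h22])
    (by rw [hf3 3 (by decide) (by decide) (by decide) (by decide), h31])
    (by rw [hf3 20 (by decide) (by decide) (by decide) (by decide), h20])
    h43 h53 (by omega)
    (by rw [hf3 9 (by decide) (by decide) (by decide) (by decide), hz 9 (by decide)]; omega)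
    (fun i hi => by rw [hD _ (by omega), headerBit]; exact decide_eq_true (by omega))
    (by rw [hD _ (by omega), headerBit]; exact decide_eq_false (by omega))) ?_
    (t₂ := 10 * h + 16) (by omega)
  rintro _ v4 ⟨rfl, h94, h44, h54, hf4⟩
  have hf4' : ∀ i, i ≠ 4 → i ≠ 5 → i ≠ 6 → i ≠ 8 → i ≠ 9 → v4 i = v2 i := by
    intro i a b c d e
    rw [hf4 i a b c e, hf3 i a b c d]
  refine Within.bind (within_readUnary hP30.append_left (by omega) (by decide) h v4
    (1 + L + 1 + q + 1)
    (by rw [hf4' 2 (by decide) (by decide) (by decide) (by decide) (by decide), h22])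
    (by rw [hf4' 3 (by decide) (by decide) (by decide) (by decide) (by decide), h31])
    (by rw [hf4' 20 (by decide) (by decide) (by decide) (by decide) (by decide), h20])
    h44 h54 (by omega)
    (by rw [hf4' 10 (by decide) (by decide) (by decide) (by decide) (by decide),
      hz 10 (by decide)]; omega)
    (fun i hi => by rw [hD _ (by omega), headerBit]; exact decide_eq_true (by omega))
    (by rw [hD _ (by omega), headerBit]; exact decide_eq_false (by omega))) ?_
    (t₂ := 6) (by omega)
  rintro _ v5 ⟨rfl, h105, -, -, hf5⟩
  rw [hf4' 10 (by decide) (by decide) (by decide) (by decide) (by decide), hz 10 (by decide),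
    zero_add] at h105
  have h95 : v5 9 = q := by
    rw [hf5 9 (by decide) (by decide) (by decide) (by decide), h94,
      hf3 9 (by decide) (by decide) (by decide) (by decide), hz 9 (by decide), zero_add]
  have h85 : v5 8 = L := by
    rw [hf5 8 (by decide) (by decide) (by decide) (by decide),
      hf4 8 (by decide) (by decide) (by decide) (by decide), h83, hz 8 (by decide), zero_add]
  have hf5' : ∀ i, i ≠ 4 → i ≠ 5 → i ≠ 6 → i ≠ 8 → i ≠ 9 → i ≠ 10 → v5 i = v2 i := by
    intro i a b c d e f
    rw [hf5 i a b c f, hf4' i a b c d e]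
  have h35 : v5 3 = 1 := by
    rw [hf5' 3 (by decide) (by decide) (by decide) (by decide) (by decide) (by decide), h31]
  have h2h : 2 ^ h < 2 ^ w := Nat.pow_lt_pow_right (by decide) hh
  refine Within.shl_one q (hP40 0 _ rfl) h35 h95 ?_
  refine Within.sub_one_mod q (hP40 1 _ rfl) (by simp) (by simp [h35]) hq ?_
  refine Within.shl_one L (hP40 2 _ rfl) (by simp [h35]) (by simp [h85]) ?_
  refine Within.sub_one_mod L (hP40 3 _ rfl) (by simp) (by simp [h35]) hL ?_
  refine Within.const 5 (hP40 4 _ rfl) (Nat.mod_eq_of_lt (by omega)) ?_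
  refine Within.shl_one h (hP40 5 _ rfl) (by simp [h35]) (by simp [h105]) (Within.done ?_)
  rw [Nat.mod_eq_of_lt h2h]
  have hfr : ∀ i, i ≤ 1 ∨ i = 2 ∨ i = 7 ∨ i = 20 ∨ i = 26 → v5 i = v2 i := fun i hi =>
    hf5' i (by omega) (by omega) (by omega) (by omega) (by omega) (by omega)
  have hfr' : ∀ i, i ≤ 1 → v5 i = v i := fun i hi => by
    rw [hfr i (by omega), hf1 i (by omega) (by omega) (by omega) (by omega) (by omega)]
  refine ⟨rfl, ⟨?_, ?_, ?_, ?_, ?_, ?_, ?_, ?_, ?_, ?_⟩, ?_, ?_, ?_⟩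
  · simp [hfr, h22]
  · simp [h35]
  · simp [hfr, h71]
  · simp [h85]
  · simp [h95]
  · simp
  · simp
  · simp
  · simp
  · simp [hfr, h20]
  · simp [hfr']
  · simp [hfr']
  · simp [hfr, hz]

theorem within_header_scan {D : List Bool} (hP : CodeAt P 0 headerCode) (hw : 2 ≤ w)
    (hD : D.getD 0 false = false) {v : ℕ → ℕ} (h2 : v 2 = w) (hv : ∀ i, 3 ≤ i → v i = 0) :
    Within w P (memNat w D) 10 0 v fun pc v' => pc = 46 ∧
      (v' 2 = w ∧ v' 3 = 1 ∧ v' 7 = 0 ∧ v' 20 = 0) ∧ v' 0 = v 0 ∧ v' 1 = v 1 ∧ v' 26 = 0 := by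
  have h4w : 2 ^ 2 ≤ 2 ^ w := Nat.pow_le_pow_right (by decide) hw
  have hP1 : CodeAt P 1 _ := hP.append_right
  have hP8 : CodeAt P 8 _ := hP1.append_right
  refine Within.const 1 (hP 0 _ rfl) (Nat.mod_eq_of_lt (by omega)) ?_
  refine Within.bind (within_getBit hP1.append_left (pos := 0) (by omega) (by simp [h2])
    (by simp) (by simp [hv]) (by simp [hv]) (by nlinarith)) ?_ (t₂ := 2) (by omega)
  rintro _ v1 ⟨rfl, h6, -, -, hf⟩
  rw [hD] at h6
  have h20 : v1 20 = 0 := by rw [hf 20 (by decide) (by decide) (by decide)]; simp [hv]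
  refine Within.copy 0 (hP8 0 _ rfl) h6 h20 ?_
  refine Within.jeq (hP8 1 _ rfl) (fun _ => Within.done ?_) (fun he => ?_)
  · simp [hf, h2, hv]
  · simp [h20] at he

/-- The bits of the main data structure: the header, and then the slots. -/
def layoutBit (w L q h : ℕ) (item : ℕ → ℕ) (pos : ℕ) : Bool :=
  if pos < 1 + L + 1 + q + 1 + h + 1 then headerBit L q h pos
  else (item (pos / w * 2 ^ q + pos % w / L)).testBit (pos % w % L)

/-- The main data structure. -/
def layout (w L q h : ℕ) (item : ℕ → ℕ) : List Bool :=
  (List.range (10 * ((2 ^ h + 1) * L))).map (layoutBit w L q h item)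

theorem getD_layout {L q h pos : ℕ} (item : ℕ → ℕ) (hpos : pos < 10 * ((2 ^ h + 1) * L)) :
    (layout w L q h item).getD pos false = layoutBit w L q h item pos := by
  rw [List.getD_eq_getElem _ _ (by simpa [layout] using hpos)]
  simp [layout]

/-- Slots `0` to `4` are never read, and the header of at most `3 * L + 4 ≤ 5 * L` bits fits in
their place. Padding of words at most doubles bit positions, so `10 * (2 ^ h + 1) * L` bits suffice.
-/
theorem slotsHold_layout {L q h : ℕ} {item : ℕ → ℕ} (hL : 2 ≤ L) (hq : q ≤ L) (hh : h ≤ L)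
    (hqw : 2 ^ q * L ≤ w) (hwq : w < 2 * (2 ^ q * L) ∨ q = L) (hLw : L ≤ w)
    (hsize : 5 * (2 ^ h + 1) ≤ 2 ^ L) (hitem : ∀ j, item j < 2 ^ L) :
    SlotsHold w (memNat w (layout w L q h item)) L q h item := by
  intro j hj hj'
  have hL2 : 2 ^ L ≤ 2 ^ w := Nat.pow_le_pow_right (by decide) hLw
  have hq0 := Nat.two_pow_pos q
  have hmod : j % 2 ^ q < 2 ^ q := Nat.mod_lt _ hq0
  have hoff : (j % 2 ^ q + 1) * L ≤ 2 ^ q * L := Nat.mul_le_mul_right _ hmod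
  rw [add_mul, one_mul] at hoff
  have hww : w < 2 ^ w := Nat.lt_two_pow_self
  have hdm := Nat.div_add_mod j (2 ^ q)
  refine ⟨by omega, by omega, Nat.eq_of_testBit_eq fun i => ?_⟩
  rw [Nat.testBit_mod_two_pow, Nat.testBit_shiftRight]
  by_cases hi : i < L
  swap
  · rw [decide_eq_false hi, Bool.false_and, Nat.testBit_eq_false_of_lt]
    exact (hitem j).trans_le (Nat.pow_le_pow_right (by decide) (not_lt.1 hi))
  rw [decide_eq_true hi, Bool.true_and, testBit_memNat _ (by
    have := Nat.div_le_self j (2 ^ q); omega) (by omega)]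
  have hpos1 : j * L ≤ j / 2 ^ q * w + j % 2 ^ q * L := by
    calc j * L = j / 2 ^ q * (2 ^ q * L) + j % 2 ^ q * L := by
          conv_lhs => rw [← hdm]
          ring
      _ ≤ _ := Nat.add_le_add_right (Nat.mul_le_mul_left _ hqw) _
  -- Either the slots fill more than half of each word, or `q = L` and all slots lie in the word at
  -- address `0`.
  have hpos2 : j / 2 ^ q * w + j % 2 ^ q * L ≤ 2 * (j * L) := by
    rcases hwq with h1 | rfl
    · calc j / 2 ^ q * w + j % 2 ^ q * L ≤
            j / 2 ^ q * (2 * (2 ^ q * L)) + 2 * (j % 2 ^ q * L) :=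
            Nat.add_le_add (Nat.mul_le_mul_left _ h1.le) (by omega)
        _ = 2 * ((2 ^ q * (j / 2 ^ q) + j % 2 ^ q) * L) := by ring
        _ = _ := by rw [hdm]
    · have hjlt : j < 2 ^ q := by omega
      rw [Nat.div_eq_of_lt hjlt, Nat.mod_eq_of_lt hjlt]
      omega
  have h5 : 5 * L ≤ j * L := Nat.mul_le_mul_right _ hj
  have hub : (j + 1) * L ≤ 5 * (2 ^ h + 1) * L := Nat.mul_le_mul_right _ hj'
  rw [add_mul, one_mul, mul_assoc] at hub
  rw [getD_layout _ (by omega), layoutBit, if_neg (by omega)]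
  have hlt : j % 2 ^ q * L + i < w := by omega
  have e1 : (j / 2 ^ q * w + (j % 2 ^ q * L + i)) / w = j / 2 ^ q := by
    rw [mul_comm, Nat.mul_add_div (by omega), Nat.div_eq_of_lt hlt, add_zero]
  have e2 : (j / 2 ^ q * w + (j % 2 ^ q * L + i)) % w = j % 2 ^ q * L + i := by
    rw [mul_comm, Nat.mul_add_mod, Nat.mod_eq_of_lt hlt]
  have e3 : (j % 2 ^ q * L + i) / L = j % 2 ^ q := by
    rw [mul_comm, Nat.mul_add_div (by omega), Nat.div_eq_of_lt hi, add_zero]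
  have e4 : (j % 2 ^ q * L + i) % L = i := by
    rw [mul_comm, Nat.mul_add_mod, Nat.mod_eq_of_lt hi]
  rw [e1, e2, e3, e4, mul_comm, hdm]

/-- The contents of the slots for a sequence of operations. -/
def blockItem (L : ℕ) (ops : List (Bool × Bool)) (k : ℕ) : ℕ :=
  let j := k / 5 - 1
  let st := (ops.take (j * L)).foldl opStep (0, 0, 0)
  if k % 5 = 0 then st.1 else if k % 5 = 1 then st.2.1 else if k % 5 = 2 then st.2.2
  else if k % 5 = 3 then Nat.ofBits fun i : Fin L => (ops.getD (j * L + i) (false, false)).1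
  else Nat.ofBits fun i : Fin L => (ops.getD (j * L + i) (false, false)).2

theorem blockItem_lt {L n : ℕ} {ops : List (Bool × Bool)} (hbd : StatesBounded n (0, 0, 0) ops)
    (hn : n < 2 ^ L) (k : ℕ) : blockItem L ops k < 2 ^ L := by
  have hst : ∀ m, _ ≤ n ∧ _ ≤ n ∧ _ ≤ n := fun m => by
    have := hbd
    rw [← List.take_append_drop m ops, statesBounded_append] at this
    exact this.2.head
  have h := hst ((k / 5 - 1) * L)
  unfold blockItem
  dsimp only
  split_ifs
  · omega
  · omega
  · omega
  · exact Nat.ofBits_lt_two_pow _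
  · exact Nat.ofBits_lt_two_pow _

theorem blocksHold_blockItem {L h : ℕ} {ops : List (Bool × Bool)} (hlen : ops.length = 2 ^ h * L) :
    BlocksHold L h (blockItem L ops) ops := by
  refine ⟨hlen, fun j _ => ⟨?_, fun i hi => ⟨?_, ?_⟩⟩⟩
  · simp only [blockItem]
    rw [show 5 * (j + 1) % 5 = 0 by omega, show (5 * (j + 1) + 1) % 5 = 1 by omega,
      show (5 * (j + 1) + 2) % 5 = 2 by omega, show 5 * (j + 1) / 5 - 1 = j by omega,
      show (5 * (j + 1) + 1) / 5 - 1 = j by omega, show (5 * (j + 1) + 2) / 5 - 1 = j by omega]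
    rfl
  · simp only [blockItem]
    rw [show (5 * (j + 1) + 3) % 5 = 3 by omega, show (5 * (j + 1) + 3) / 5 - 1 = j by omega]
    exact Nat.testBit_ofBits_lt _ i hi
  · simp only [blockItem]
    rw [show (5 * (j + 1) + 4) % 5 = 4 by omega, show (5 * (j + 1) + 4) / 5 - 1 = j by omega]
    exact Nat.testBit_ofBits_lt _ i hi

theorem toNats_initial {x y : ℕ} (hx : x < 2 ^ w) (hy : y < 2 ^ w) :
    (initial w x y).toNats.2 0 = x ∧ (initial w x y).toNats.2 1 = y ∧
      (initial w x y).toNats.2 2 = w ∧ ∀ i, 3 ≤ i → (initial w x y).toNats.2 i = 0 := by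
  have hww : w < 2 ^ w := Nat.lt_two_pow_self
  refine ⟨?_, ?_, ?_, fun i hi => ?_⟩
  · simp [initial, Config.toNats, Nat.mod_eq_of_lt hx]
  · simp [initial, Config.toNats, Nat.mod_eq_of_lt hy]
  · simp [initial, Config.toNats, Nat.mod_eq_of_lt hww]
  · simp [initial, Config.toNats, show i ≠ 0 by omega, show i ≠ 1 by omega, show i ≠ 2 by omega]

end Program

end WordRAM

/-! ### Choice of the parameters, and the two data structures -/

namespace WordRAM

theorem exists_foldl_groupOps (R : List (ℕ × ℕ)) (p prev : ℕ)
    (hR : (prev :: R.map Prod.fst).Pairwise (· ≤ ·)) :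
    ∃ s, (groupOps prev R).foldl opStep (p, prev, 0) =
      (p + (R.map fun g => g.1 * g.2).sum, s, 0) := by
  induction R generalizing p prev with
  | nil => exact ⟨prev, rfl⟩
  | cons g R ih =>
    obtain ⟨s, m⟩ := g
    rw [List.map_cons, List.pairwise_cons] at hR
    rw [groupOps, List.foldl_append, foldl_record _ _ _ _ (hR.1 _ (by simp))]
    simpa [add_assoc] using ih (p + s * m) s hR.2

theorem foldl_replicate_zero (p s k : ℕ) :
    (List.replicate k (false, false)).foldl opStep (p, s, 0) = (p, s, 0) := by
  induction k with
  | zero => rfl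
  | succ k ih => exact ih

theorem statesBounded_replicate_zero {n p s : ℕ} (hp : p ≤ n) (hs : s ≤ n) (k : ℕ) :
    StatesBounded n (p, s, 0) (List.replicate k (false, false)) := by
  induction k with
  | zero => exact ⟨hp, hs, Nat.zero_le _⟩
  | succ k ih => exact ⟨⟨hp, hs, Nat.zero_le _⟩, ih⟩

/-- Rounding the number of blocks up to a power of two costs at most a factor `2`. -/
theorem exists_block_exponent (T : ℕ) {L : ℕ} (hL : 1 ≤ L) :
    ∃ h, T ≤ 2 ^ h * L ∧ 2 ^ h * L ≤ 2 * T + 2 * L ∧ 2 ^ h ≤ 2 * T + 2 := by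
  have h1 : T < (T / L + 1) * L := by
    rw [add_mul, one_mul]
    have := Nat.div_add_mod' T L
    have := Nat.mod_lt T hL
    omega
  have h2 : T / L + 1 ≤ 2 ^ Nat.clog 2 (T / L + 1) := Nat.le_pow_clog (by decide) _
  have h3 : 2 ^ Nat.clog 2 (T / L + 1) ≤ 2 * (T / L + 1) := by
    rcases Nat.eq_zero_or_pos (T / L) with h0 | h0
    · simp [h0]
    · have := Nat.pow_pred_clog_lt_self (b := 2) (by decide) (show 1 < T / L + 1 by omega)
      have hc := Nat.clog_pos (b := 2) (by decide) (show 2 ≤ T / L + 1 by omega)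
      obtain ⟨c, hc'⟩ : ∃ c, Nat.clog 2 (T / L + 1) = c + 1 := ⟨_, (Nat.sub_add_cancel hc).symm⟩
      rw [hc'] at this ⊢
      rw [Nat.pred_succ] at this
      rw [pow_succ]
      omega
  refine ⟨Nat.clog 2 (T / L + 1), h1.le.trans (Nat.mul_le_mul_right _ h2), ?_, ?_⟩
  · refine (Nat.mul_le_mul_right L h3).trans ?_
    have := Nat.div_mul_le_self T L
    nlinarith
  · have := Nat.div_le_self T L
    omega

/-- The exponent is the smaller of `log₂ (w / L)`, rounded down, and `L`. The cap at `L` keeps the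
unary header, and the time to read it, in `O(L)` even for enormous words. -/
theorem exists_slot_exponent {w L : ℕ} (hL : 1 ≤ L) (hLw : L ≤ w) :
    ∃ q ≤ L, 2 ^ q * L ≤ w ∧ (w < 2 * (2 ^ q * L) ∨ q = L) := by
  have h0 : w / L ≠ 0 := (Nat.div_pos hLw hL).ne'
  have h1 : 2 ^ Nat.log 2 (w / L) ≤ w / L := Nat.pow_log_le_self 2 h0
  have h2 : w / L < 2 ^ (Nat.log 2 (w / L) + 1) := Nat.lt_pow_succ_log_self (by decide) _
  rcases le_total (Nat.log 2 (w / L)) L with h | h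
  · refine ⟨_, h, (Nat.le_div_iff_mul_le hL).1 h1, Or.inl ?_⟩
    rw [← mul_assoc, mul_comm 2, ← pow_succ]
    exact (Nat.div_lt_iff_lt_mul hL).1 h2
  · refine ⟨L, le_rfl, (Nat.le_div_iff_mul_le hL).1 (le_trans ?_ h1), Or.inr rfl⟩
    exact Nat.pow_le_pow_right (by decide) h

/-- The query program, with `D` in memory, computes whether `f` agrees on two elements of
`{0, …, n - 1}`. -/
def Decides (w : ℕ) (D : List Bool) (n : ℕ) (f : ℕ → ℕ) (t : ℕ) : Prop :=
  ∀ x y, x < n → y < n → Within w queryProgram (memNat w D) t 0 (initial w (x + 1) (y + 1)).toNats.2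
    fun pc v => pc = 154 ∧ v 0 = if f x = f y then 1 else 0

theorem exists_main_store {R : List (ℕ × ℕ)} {n w : ℕ} (hpos : ∀ g ∈ R, 1 ≤ g.1 ∧ 1 ≤ g.2)
    (hR : (R.map Prod.fst).Pairwise (· < ·)) (hsum : (R.map fun g => g.1 * g.2).sum = n)
    (hn : 2 ^ 18 ≤ n) (hw : n < 2 ^ w) :
    ∃ D : List Bool, D.length ≤ 20 * (groupOps 0 R).length + 30 * Nat.size n ∧
      Decides w D n (pieceStart (groupSizes R)) (98 * Nat.size n + 153) := by
  set T := (groupOps 0 R).length with hT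
  set L := Nat.size n with hLdef
  have hnL : n < 2 ^ L := Nat.lt_size_self n
  have hLw : L ≤ w := Nat.size_le.2 hw
  have hL18 : 18 < L := Nat.lt_size.2 hn
  obtain ⟨h, hh1, hh2, hh3⟩ := exists_block_exponent T (show 1 ≤ L by omega)
  obtain ⟨q, hqL, hqw, hwq⟩ := exists_slot_exponent (show 1 ≤ L by omega) hLw
  -- This is where `n ≥ 2 ^ 18` enters. With `T ≤ 40 * √n` and `2 ^ h ≤ 2 * T + 2` it gives `5 * (2
  -- ^ h + 1) ≤ 10 * T + 15 ≤ n < 2 ^ L`, so slot numbers fit into `L` bits.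
  have hTn : 400 * √(n : ℝ) + 15 ≤ n := by
    have hs : (512 : ℝ) ≤ √(n : ℝ) := by
      refine Real.le_sqrt_of_sq_le ?_
      norm_num at hn ⊢
      exact_mod_cast hn
    nlinarith [Real.mul_self_sqrt (show (0 : ℝ) ≤ n by positivity)]
  have hlen := length_groupOps_le R (show 1 ≤ n by omega) hpos hR hsum
  rw [← hT] at hlen
  have hT10 : 10 * T + 15 ≤ n := by
    have : (10 * T + 15 : ℝ) ≤ n := by linarith
    exact_mod_cast this
  have hhL : h < L := (Nat.pow_lt_pow_iff_right (a := 2) (by decide)).1 (by omega)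
  have hR' : (0 :: R.map Prod.fst).Pairwise (· ≤ ·) :=
    List.pairwise_cons.2 ⟨fun _ _ => Nat.zero_le _, hR.imp fun h => h.le⟩
  have hbd0 := statesBounded_groupOps R 0 0 (Nat.zero_le n) hpos hR' (by rw [zero_add, hsum])
  obtain ⟨s, hs⟩ := exists_foldl_groupOps R 0 0 hR'
  rw [zero_add, hsum] at hs
  -- The padding appends zeros to an accumulator that is already `0`, so it changes no state.
  set ops := groupOps 0 R ++ List.replicate (2 ^ h * L - T) (false, false) with hops
  have hsn : s ≤ n := by
    have := (statesBounded_append (n := n) (groupOps 0 R) [] (0, 0, 0)).1 (by rwa [List.append_nil])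
    rw [hs] at this
    exact this.2.2.1
  have hbd : StatesBounded n (0, 0, 0) ops := by
    rw [hops, statesBounded_append, hs]
    exact ⟨hbd0, statesBounded_replicate_zero le_rfl hsn _⟩
  have hfin : (ops.foldl opStep (0, 0, 0)).1 = n := by
    rw [hops, List.foldl_append, hs, foldl_replicate_zero]
  have hopslen : ops.length = 2 ^ h * L := by
    rw [hops, List.length_append, List.length_replicate]
    omega
  have hslots := slotsHold_layout (w := w) (h := h) (show 2 ≤ L by omega) hqL hhL.le hqw hwq hLw
    (by omega) (blockItem_lt hbd hnL)
  refine ⟨layout w L q h (blockItem L ops), ?_, fun x y hx hy => ?_⟩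
  · simp only [layout, List.length_map, List.length_range]
    rw [add_mul]
    omega
  obtain ⟨hP0, hP1, hP2, hP3, hP4, hP5, -, hP7⟩ := codeAt_queryProgram
  obtain ⟨h0, h1, h2, h3⟩ := toNats_initial (w := w) (x := x + 1) (y := y + 1) (by omega) (by omega)
  have hww : w < 2 ^ w := Nat.lt_two_pow_self
  have h8w : 2 ^ 3 ≤ 2 ^ w := Nat.pow_le_pow_right (by decide) (by omega)
  have hbig : w * 8 ≤ w * 2 ^ w := Nat.mul_le_mul_left _ h8w
  have h1L : 19 * L ≤ 2 ^ h * L + 18 * L := by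
    have := Nat.le_mul_of_pos_left L (Nat.two_pow_pos h)
    omega
  refine Within.bind (within_header_main (L := L) (q := q) (h := h) hP0 (by omega) hLw (by omega) (by omega) (by omega)
    (fun pos hp => ?_) h2 h3) ?_ (t₂ := 2 * (13 * h + 21 * L + 49) + 9) (by omega)
  · rw [getD_layout _ (by rw [add_mul]; omega), layoutBit, if_pos hp]
  rintro _ v ⟨rfl, hv, hv0, hv1, hv26⟩
  refine within_answer hP7 (by omega) (Inv := MainRegs w L q h) (n := n)
    (rep := pieceStart (groupSizes R)) (fun v v' H hf => H.congr hf) (fun v H => ⟨H.h3, H.h20⟩)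
    (fun v x H hx0 hx => ?_) hv (hv0.trans h0) (hv1.trans h1) hv26 hx hy
  refine Within.bind (within_main hP1 hP2 hP3 hP4 hP5 hslots (blocksHold_blockItem hopslen) hbd hw
    hnL hfin hx H hx0) ?_ (t₂ := 0) (by omega)
  rintro _ v' ⟨rfl, hres, hf⟩
  refine Within.done ⟨rfl, ?_, H.congr fun i hi => hf i (by omega), fun i hi => hf i (by omega)⟩
  rw [hres, hops, findStart_groupOps R 0 0 hR' (Nat.zero_le x) (by rwa [zero_add, hsum]), zero_add,
    Nat.sub_zero]

theorem exists_scan_store {cs : List ℕ} {n w : ℕ} (hcs : ∀ c ∈ cs, 1 ≤ c) (hn : 2 ≤ n)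
    (hw : n < 2 ^ w) :
    ∃ D : List Bool, D.length = n + 1 ∧ Decides w D n (pieceStart cs) (24 * n + 53) := by
  refine ⟨false :: (List.range n).map fun i => decide (pieceStart cs i = i), by simp,
    fun x y hx hy => ?_⟩
  have hw2 : 2 ≤ w := by
    by_contra hlt
    have := Nat.pow_le_pow_right (show 0 < 2 by decide) (show w ≤ 1 by omega)
    omega
  have h2w : 2 * 2 ^ w ≤ w * 2 ^ w := Nat.mul_le_mul_right _ hw2
  obtain ⟨hP0, hP1, -, -, -, -, hP6, hP7⟩ := codeAt_queryProgram
  obtain ⟨h0, h1, h2, h3⟩ := toNats_initial (w := w) (x := x + 1) (y := y + 1) (by omega) (by omega)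
  refine Within.bind (within_header_scan hP0 hw2 rfl h2 h3) ?_ (t₂ := 2 * (12 * n + 17) + 9)
    (by omega)
  rintro _ v ⟨rfl, hv, hv0, hv1, hv26⟩
  refine within_answer hP7 (by omega)
    (Inv := fun v => v 2 = w ∧ v 3 = 1 ∧ v 7 = 0 ∧ v 20 = 0) (n := n) (rep := pieceStart cs)
    (fun v v' H hf => ?_) (fun v H => ⟨H.2.1, H.2.2.2⟩) (fun v x H hx0 hx => ?_) hv
    (hv0.trans h0) (hv1.trans h1) hv26 hx hy
  · rw [hf 2 (by decide), hf 3 (by decide), hf 7 (by decide), hf 20 (by decide)]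
    exact H
  · obtain ⟨H2, H3, H7, H20⟩ := H
    refine Within.bind (within_scan hP1 hP6 hw2 (by omega) (by omega) hcs (fun i hi => ?_) hx0 H2 H3
      H7 H20) ?_ (t₂ := 0) (by omega)
    · rw [add_comm, List.getD_cons_succ, List.getD_eq_getElem _ _ (by simp; omega)]
      simp
    rintro _ v' ⟨rfl, hres, hf⟩
    refine Within.done ⟨rfl, hres, ?_, fun i hi => hf i (by omega)⟩
    exact ⟨by rw [hf 2 (by decide), H2], by rw [hf 3 (by decide), H3], by rw [hf 7 (by decide), H7],
      by rw [hf 20 (by decide), H20]⟩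

theorem exists_store {R : List (ℕ × ℕ)} {n w : ℕ} (hpos : ∀ g ∈ R, 1 ≤ g.1 ∧ 1 ≤ g.2)
    (hR : (R.map Prod.fst).Pairwise (· < ·)) (hsum : (R.map fun g => g.1 * g.2).sum = n)
    (hn : 2 ≤ n) (hw : n < 2 ^ w) :
    ∃ (D : List Bool) (t : ℕ), (D.length : ℝ) ≤ 10 ^ 7 * √(n : ℝ) ∧
      (t : ℝ) ≤ 10 ^ 7 * Real.logb 2 n ∧ Decides w D n (pieceStart (groupSizes R)) t := by
  have hnR : (2 : ℝ) ≤ n := by exact_mod_cast hn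
  have hlog : 1 ≤ Real.logb 2 n := by
    rw [Real.le_logb_iff_rpow_le (by norm_num) (by linarith), Real.rpow_one]
    exact hnR
  have hsqrt : 1 ≤ √(n : ℝ) := Real.one_le_sqrt.2 (by linarith)
  -- Below the threshold, `n + 1` bits and `24 * n + 53` steps are bounded by constants, which the
  -- factor `10 ^ 7` absorbs.
  rcases lt_or_ge n (2 ^ 18) with hlt | hge
  · have hltR : (n : ℝ) ≤ 2 ^ 18 := by exact_mod_cast hlt.le
    have hcs : ∀ c ∈ groupSizes R, 1 ≤ c := by
      intro c hc
      obtain ⟨g, hg, hc⟩ := List.mem_flatMap.1 hc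
      rw [List.eq_of_mem_replicate hc]
      exact (hpos g hg).1
    obtain ⟨D, hD, hdec⟩ := exists_scan_store hcs hn hw
    refine ⟨D, _, ?_, ?_, hdec⟩
    · rw [hD]
      push_cast
      nlinarith
    · push_cast
      nlinarith
  · obtain ⟨D, hD, hdec⟩ := exists_main_store hpos hR hsum hge hw
    have hsize := size_le_logb (show 1 ≤ n by omega)
    refine ⟨D, _, ?_, ?_, hdec⟩
    · have hlen := length_groupOps_le R (show 1 ≤ n by omega) hpos hR hsum
      have h1 : Real.logb 2 n ≤ 4 * √(n : ℝ) := by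
        have h2 := logb_le_two_mul_log hsqrt
        have h3 := Real.log_le_sub_one_of_pos (show 0 < √(n : ℝ) by linarith)
        have h4 : Real.logb 2 n = 2 * Real.logb 2 √(n : ℝ) := by
          conv_lhs => rw [← Real.sq_sqrt (show (0 : ℝ) ≤ n by linarith)]
          rw [Real.logb_pow]
          norm_num
        linarith
      have hDR : (D.length : ℝ) ≤ 20 * (groupOps 0 R).length + 30 * Nat.size n := by
        exact_mod_cast hD
      linarith
    · push_cast
      linarith

theorem exists_labeling_and_store {α : Type u} [Fintype α] (r : Setoid α) (w : ℕ)
    (hn : 2 ≤ Fintype.card α) (hw : Fintype.card α < 2 ^ w) :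
    ∃ (label : α → ℕ) (D : List Bool), IsLabeling label ∧
      (D.length : ℝ) ≤ 10 ^ 7 * √(Fintype.card α : ℝ) ∧
      ∀ x y : α, ∃ t : ℕ, (t : ℝ) ≤ 10 ^ 7 * Real.logb 2 (Fintype.card α) ∧
        (r x y → AnswersWithin queryProgram w D (label x) (label y) 1 t) ∧
        (¬ r x y → AnswersWithin queryProgram w D (label x) (label y) 0 t) := by
  obtain ⟨R, label, hpos, hR, hsum, hlabel, hr⟩ := exists_labeling r
  obtain ⟨D, t, hD, ht, hdec⟩ := exists_store hpos hR hsum hn hw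
  have h1w : 1 < 2 ^ w := by omega
  refine ⟨label, D, hlabel, hD, fun x y => ⟨t, ht, ?_⟩⟩
  have hlab : ∀ x, ∃ x', label x = x' + 1 ∧ x' < Fintype.card α := by
    intro x
    have := Set.mem_Icc.1 (hlabel.mapsTo (Set.mem_univ x))
    exact ⟨label x - 1, by omega, by omega⟩
  obtain ⟨x', hx, hx'⟩ := hlab x
  obtain ⟨y', hy, hy'⟩ := hlab y
  have key : ∀ a : BitVec w,
      (a.toNat = if pieceStart (groupSizes R) x' = pieceStart (groupSizes R) y' then 1 else 0) →
      AnswersWithin queryProgram w D (label x) (label y) a t := by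
    intro a ha
    rw [hx, hy]
    refine answersWithin_of_within (Within.bind (hdec x' y' hx' hy') ?_ (t₂ := 0) le_rfl)
    rintro _ v ⟨rfl, hv⟩
    exact Within.done ⟨length_queryProgram.le, by rw [hv, ha]⟩
  have hiff := hr x y
  rw [hx, hy, Nat.add_sub_cancel, Nat.add_sub_cancel] at hiff
  refine ⟨fun h => key 1 ?_, fun h => key 0 ?_⟩
  · rw [if_pos (hiff.1 h)]
    exact (BitVec.toNat_ofNat 1 w).trans (Nat.mod_eq_of_lt h1w)
  · rw [if_neg fun he => h (hiff.2 he)]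
    simp

end WordRAM

/-! ### The number of integer partitions from above, and the theorem -/

/-- The data structure for `Fin n`, with word length `n`, meets the hypotheses of the counting
lemma, with "the program answers `1`" as the rule; so `p(n)` is smaller than `2` to one more than
its rounded-down length bound. -/
theorem card_partition_le_rpow_sqrt {n : ℕ} (hn : 2 ≤ n) :
    (Fintype.card (Nat.Partition n) : ℝ) ≤ (2 : ℝ) ^ ((10 ^ 7 + 1) * √(n : ℝ)) := by
  have hsqrt : 1 ≤ √(n : ℝ) := Real.one_le_sqrt.2 (by exact_mod_cast (show 1 ≤ n by omega))
  have hw : Fintype.card (Fin n) < 2 ^ n := by rw [Fintype.card_fin]; exact Nat.lt_two_pow_self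
  choose label store hlabel hlen hans using fun r : Setoid (Fin n) =>
    WordRAM.exists_labeling_and_store r n (by rwa [Fintype.card_fin]) hw
  have h := card_partition_lt_of_store label store
    (fun D x y => ∃ t, WordRAM.AnswersWithin WordRAM.queryProgram n D x y 1 t) hlabel
    (fun r x y => ?_) (⌊10 ^ 7 * √(n : ℝ)⌋₊ + 1) (fun r => ?_)
  · rw [Fintype.card_fin] at h
    calc (Fintype.card (Nat.Partition n) : ℝ)
        ≤ (2 : ℝ) ^ ((⌊10 ^ 7 * √(n : ℝ)⌋₊ + 1 : ℕ) : ℝ) := by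
          rw [Real.rpow_natCast]; exact_mod_cast h.le
      _ ≤ _ := by
          refine Real.rpow_le_rpow_of_exponent_le (by norm_num) ?_
          have := Nat.floor_le (show 0 ≤ 10 ^ 7 * √(n : ℝ) by positivity)
          push_cast
          linarith
  · obtain ⟨t, -, h1, h0⟩ := hans r x y
    refine ⟨fun ⟨t', ht'⟩ => ?_, fun hr => ⟨t, h1 hr⟩⟩
    by_contra hr
    have := congrArg BitVec.toNat (WordRAM.answersWithin_unique ht' (h0 hr))
    change (BitVec.ofNat n 1).toNat = (BitVec.ofNat n 0).toNat at this
    rw [BitVec.toNat_ofNat, BitVec.toNat_ofNat, Nat.zero_mod,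
      Nat.mod_eq_of_lt (Nat.one_lt_two_pow (by omega))] at this
    omega
  · have := hlen r
    rw [Fintype.card_fin] at this
    exact Nat.lt_succ_of_le (Nat.le_floor this)

theorem theorem3 :
    -- one program and one constant for all `n`, all partitions and all word lengths:
    -- `O(√n)` bits, and queries in `O(lg n)` time
    (∃ (P : WordRAM.Program) (C : ℝ),
      ∀ (α : Type u) [Fintype α] (r : Setoid α) (w : ℕ),
        2 ≤ Fintype.card α → Fintype.card α < 2 ^ w →
        ∃ (label : α → ℕ) (D : List Bool),
          IsLabeling label ∧
          (D.length : ℝ) ≤ C * √(Fintype.card α : ℝ) ∧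
          ∀ x y : α, ∃ t : ℕ, (t : ℝ) ≤ C * Real.logb 2 (Fintype.card α) ∧
            (r x y → WordRAM.AnswersWithin P w D (label x) (label y) 1 t) ∧
            (¬ r x y → WordRAM.AnswersWithin P w D (label x) (label y) 0 t)) ∧
    -- `Ω(√n)` bits are necessary in the worst case, whatever the labelings, the stored bit strings
    -- and the way in which the queries are answered from them
    (∃ c : ℝ, 0 < c ∧
      ∀ (α : Type u) [Fintype α], 2 ≤ Fintype.card α →
        ∀ (label : Setoid α → α → ℕ) (store : Setoid α → List Bool)
          (answer : List Bool → ℕ → ℕ → Prop),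
          (∀ r, IsLabeling (label r)) →
          (∀ (r : Setoid α) (x y : α), answer (store r) (label r x) (label r y) ↔ r x y) →
          ∃ r, c * √(Fintype.card α : ℝ) ≤ ((store r).length : ℝ)) ∧
    -- the number of partitions of `n` is `2 ^ Θ(√n)`
    (∃ c C : ℝ, 0 < c ∧ ∀ n : ℕ, 2 ≤ n →
      (2 : ℝ) ^ (c * √(n : ℝ)) ≤ (Fintype.card (Nat.Partition n) : ℝ) ∧
      (Fintype.card (Nat.Partition n) : ℝ) ≤ (2 : ℝ) ^ (C * √(n : ℝ))) ∧
    -- for a partition of an `n`-element set with `m j` classes of size `s j`, `j = 1, …, k`, the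
    -- sizes being distinct and ordered by `s j * m j`: the sums of `lg δ j` and of `lg (m j)`
    (∃ C : ℝ, ∀ (n k : ℕ) (s m δ : ℕ → ℕ),
      (∀ j ∈ Finset.Icc 1 k, 1 ≤ s j ∧ 1 ≤ m j) →
      Set.InjOn s (Set.Icc 1 k) →
      s 0 * m 0 = 0 →
      (∀ j ∈ Finset.Icc 1 k, s j * m j = s (j - 1) * m (j - 1) + δ j) →
      ∑ j ∈ Finset.Icc 1 k, s j * m j = n →
      ∑ j ∈ Finset.Icc 1 k with 1 ≤ δ j, Real.logb 2 (δ j) ≤ C * √(n : ℝ) ∧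
      ∑ j ∈ Finset.Icc 1 k, Real.logb 2 (m j) ≤ C * √(n : ℝ)) := by
  refine ⟨⟨WordRAM.queryProgram, 10 ^ 7, fun α _ r w hn hw =>
    WordRAM.exists_labeling_and_store r w hn hw⟩, ⟨1 / 4, by norm_num, ?_⟩,
    ⟨1 / 4, 10 ^ 7 + 1, by norm_num, fun n hn =>
      ⟨rpow_sqrt_le_card_partition hn, card_partition_le_rpow_sqrt hn⟩⟩, ⟨4, ?_⟩⟩
  · intro α _ hα label store answer hlabel hans
    exact exists_store_length_ge hα label store answer hlabel hans
  · intro n k s m δ hpos hinj h0 hδ hn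
    exact sum_logb_increments_and_multiplicities n k s m δ hpos hinj h0 hδ hn
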